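/- A graph $\Gamma$ here is a directed graph with vertex set $V_\Gamma$ and edge set $E_\Gamma$, possibly with loops and multiple edges, with weights $w(e)\in\mathbb{Z}_{>0}$; the weight $w(p)$ of a walk $p$ is the sum of the weights of its edges. A periodic graph $(\Gamma,L)$ is such a graph together with a free abelian group $L$ of finite rank acting freely on $V_\Gamma$ and on $E_\Gamma$, compatibly with sources, targets and weights, such that $V_\Gamma/L$ and $E_\Gamma/L$ are finite. Let $\Gamma/L$ be the quotient graph, $\overline{x}$ the class of $x\in V_\Gamma$, and $L_{\mathbb R}=L\otimes_{\mathbb Z}\mathbb R$. A cycle in $\Gamma/L$ is a closed walk $e_1\cdots e_\ell$ with $\ell\ge 1$ whose vertices $t(e_1),\dots,t(e_\ell)$ are distinct. For a cycle $q$ let $\mu(q)\in L$ be the element $u$ with $t(p)=u+s(p)$, where $p$ is any lift of $q$ to a walk in $\Gamma$, and put $\nu(q)=\mu(q)/w(q)\in L_{\mathbb R}$. The growth polytope is $P_\Gamma=\operatorname{conv}(\{\nu(q) : q \text{ a cycle in }\Gamma/L\}\cup\{0\})$, and $V(P_\Gamma)$ is its set of vertices. A vertex $x_0\in V_\Gamma$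 is $P$-initial if for every $v\in V(P_\Gamma)\setminus\{0\}$ there is a cycle $q$ in $\Gamma/L$ passing through $\overline{x_0}$ with $\nu(q)=v$. Let $d_\Gamma(x,y)\in\mathbb{Z}_{\ge0}\cup\{\infty\}$ be the least weight of a walk from $x$ to $y$; the growth sequence from $x_0$ is $s_i=\#\{y\in V_\Gamma : d_\Gamma(x_0,y)=i\}$, and the growth series is $G_{\Gamma,x_0}(t)=\sum_{i\ge0}s_it^i$. A positive integer $N$ is a quasi-period of a sequence $(g_i)_{i\ge 0}$ if there are polynomials $Q_0,\dots,Q_{N-1}\in\mathbb{C}[x]$ with $g_i=Q_r(i)$ for all sufficiently large $i$ and all $r\in\{0,\dots,N-1\}$ with $i\equiv r \pmod N$. **Theorem.** Let $(\Gamma,L)$ be a periodic graph and let $x_0\in V_\Gamma$ be $P$-initial. For each $v\in V(P_\Gamma)\setminus\{0\}$ choose a cycle $q_v$ in $\Gamma/L$ with $\nu(q_v)=v$ passing through $\overline{x_0}$. Then $$\operatorname{LCM}\{w(q_v) : v\in V(P_\Gamma)\setminus\{0\}\}$$ is a quasi-period of the growth sequence $(s_i)_i$, and more precisely $$G_{\Gamma,x_0}(t)=\frac{Q(t)}{\prod_{v\in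 V(P_\Gamma)\setminus\{0\}}\bigl(1-t^{w(q_v)}\bigr)}$$ for some polynomial $Q(t)\in\mathbb{Z}[t]$. In particular, if $w(e)=1$ for every edge $e$, then $\operatorname{LCM}\{1,2,\dots,\#(V_\Gamma/L)\}$ is a quasi-period of the growth sequence. -/

import Mathlib

open scoped TensorProduct

/-- A directed weighted graph, possibly with loops and multiple edges. -/
structure WGraph (V E : Type*) where
  /-- source -/
  s : E → V
  /-- target -/
  t : E → V
  /-- weight -/
  w : E → ℕ
  w_pos : ∀ e, 0 < w e

namespace WGraph

variable {V E : Type*} (Γ : WGraph V E)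

/-- `Γ.IsWalk x p y`: the sequence of edges `p` is a walk from `x` to `y`.
The empty sequence is the trivial walk from `x` to `x`. -/
def IsWalk : V → List E → V → Prop
  | x, [], y => x = y
  | x, e :: p, y => Γ.s e = x ∧ IsWalk (Γ.t e) p y

/-- The weight of a walk. -/
def weight (p : List E) : ℕ := (p.map Γ.w).sum

/-- A cycle: a nontrivial closed walk `e₁ ⋯ e_ℓ` with `t(e₁), …, t(e_ℓ)` distinct. -/
def IsCycle (p : List E) : Prop :=
  p ≠ [] ∧ (∃ x, Γ.IsWalk x p x) ∧ (p.map Γ.t).Nodup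

/-- The set of vertices visited by a nontrivial walk. -/
def supp (p : List E) : Set V := {x | ∃ e ∈ p, Γ.s e = x ∨ Γ.t e = x}

/-- `d(x, y)`: the least weight of a walk from `x` to `y`, and `⊤` if there is none. -/
noncomputable def dist (x y : V) : ℕ∞ :=
  ⨅ (p : List E) (_ : Γ.IsWalk x p y), (Γ.weight p : ℕ∞)

/-- The sphere `{y | d(x₀, y) = i}`. -/
def sphere (x₀ : V) (i : ℕ) : Set V := {y | Γ.dist x₀ y = i}

/-- The growth sequence with start point `x₀` (for a periodic graph the spheres are finite:
`PeriodicGraph.finite_sphere`). -/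
noncomputable def growthSeq (x₀ : V) (i : ℕ) : ℕ := (Γ.sphere x₀ i).ncard

/-- The growth series `∑ sᵢ tⁱ`. -/
noncomputable def growthSeries (x₀ : V) : PowerSeries ℤ :=
  PowerSeries.mk fun i => (Γ.growthSeq x₀ i : ℤ)

/-- All weights are `1`. -/
def Unweighted : Prop := ∀ e, Γ.w e = 1

end WGraph

/-- A periodic graph with vertex set `V`, edge set `E` and period lattice `L`
(which is assumed free of finite rank wherever it matters). -/
structure PeriodicGraph (L V E : Type*) [AddCommGroup L] [AddAction L V] [AddAction L E]
    extends WGraph V E where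
  free_V : ∀ (u : L) (x : V), u +ᵥ x = x → u = 0
  free_E : ∀ (u : L) (e : E), u +ᵥ e = e → u = 0
  finite_V : Finite (AddAction.orbitRel.Quotient L V)
  finite_E : Finite (AddAction.orbitRel.Quotient L E)
  s_vadd : ∀ (u : L) (e : E), s (u +ᵥ e) = u +ᵥ s e
  t_vadd : ∀ (u : L) (e : E), t (u +ᵥ e) = u +ᵥ t e
  w_vadd : ∀ (u : L) (e : E), w (u +ᵥ e) = w e

/-- The class of `x` modulo `L`. -/
def orbitClass (L : Type*) {X : Type*} [AddCommGroup L] [AddAction L X] (x : X) :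
    AddAction.orbitRel.Quotient L X :=
  Quotient.mk (AddAction.orbitRel L X) x

theorem orbitClass_eq_iff {L X : Type*} [AddCommGroup L] [AddAction L X] {x y : X} :
    orbitClass L x = orbitClass L y ↔ ∃ u : L, u +ᵥ y = x := by
  unfold orbitClass
  rw [Quotient.eq]
  exact Iff.rfl

namespace PeriodicGraph

variable {L V E : Type*} [AddCommGroup L] [AddAction L V] [AddAction L E]
variable (Γ : PeriodicGraph L V E)

/-- The quotient graph `Γ / L`. -/
def quot : WGraph (AddAction.orbitRel.Quotient L V) (AddAction.orbitRel.Quotient L E) where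
  s := Quotient.lift (fun e => orbitClass L (Γ.s e)) (by
    rintro _ b ⟨u, rfl⟩
    exact orbitClass_eq_iff.2 ⟨u, (Γ.s_vadd u b).symm⟩)
  t := Quotient.lift (fun e => orbitClass L (Γ.t e)) (by
    rintro _ b ⟨u, rfl⟩
    exact orbitClass_eq_iff.2 ⟨u, (Γ.t_vadd u b).symm⟩)
  w := Quotient.lift Γ.w (by
    rintro _ b ⟨u, rfl⟩
    exact Γ.w_vadd u b)
  w_pos := by
    rintro ⟨e⟩
    exact Γ.w_pos e

/-- A periodic realization: an `L`-equivariant map `Φ : V → L_ℝ = ℝ ⊗ L`. -/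
def IsRealization (_Γ : PeriodicGraph L V E) (Φ : V → ℝ ⊗[ℤ] L) : Prop :=
  ∀ (u : L) (x : V), Φ (u +ᵥ x) = (1 : ℝ) ⊗ₜ[ℤ] u + Φ x

/-- A periodic realization exists: send `u + r` to `1 ⊗ u`, with `r` running through
representatives of the vertex classes. -/
theorem exists_isRealization : ∃ Φ : V → ℝ ⊗[ℤ] L, Γ.IsRealization Φ := by
  have h : ∀ x : V, ∃ u : L, u +ᵥ (orbitClass L x).out = x := fun x =>
    orbitClass_eq_iff.1 (Quotient.out_eq (orbitClass L x)).symm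
  choose c hc using h
  refine ⟨fun x => (1 : ℝ) ⊗ₜ[ℤ] c x, fun u x => ?_⟩
  have hcl : orbitClass L (u +ᵥ x) = orbitClass L x := orbitClass_eq_iff.2 ⟨u, rfl⟩
  have h1 := hc (u +ᵥ x)
  rw [hcl] at h1
  have h2 : (u + c x) +ᵥ (orbitClass L x).out = u +ᵥ x := by rw [add_vadd, hc x]
  have h3 : c (u +ᵥ x) = u + c x := by
    have h4 : (-(c (u +ᵥ x)) + (u + c x)) +ᵥ (orbitClass L x).out = (orbitClass L x).out := by
      rw [add_vadd, h2]
      exact (congrArg (fun z => -(c (u +ᵥ x)) +ᵥ z) h1).symm.trans (neg_vadd_vadd _ _)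
    have h5 := Γ.free_V _ _ h4
    rw [neg_add_eq_zero] at h5
    exact h5
  simp only [h3, TensorProduct.tmul_add]

/-- `μ_Φ` on an edge of `Γ / L`: the vector `Φ(t(e)) - Φ(s(e))` for any representative `e`. -/
noncomputable def edgeVec {Φ : V → ℝ ⊗[ℤ] L} (hΦ : Γ.IsRealization Φ) :
    AddAction.orbitRel.Quotient L E → ℝ ⊗[ℤ] L :=
  Quotient.lift (fun e => Φ (Γ.t e) - Φ (Γ.s e)) (by
    rintro _ b ⟨u, rfl⟩
    simp only [Γ.t_vadd, Γ.s_vadd, hΦ u]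
    abel)

/-- `μ_Φ(⟨q⟩)` for a sequence `q` of edges of `Γ / L`. -/
noncomputable def muRealization {Φ : V → ℝ ⊗[ℤ] L} (hΦ : Γ.IsRealization Φ)
    (q : List (AddAction.orbitRel.Quotient L E)) : ℝ ⊗[ℤ] L :=
  (q.map (Γ.edgeVec hΦ)).sum

/-- `μ(⟨q⟩)` for a closed walk `q` in `Γ / L`, as an element of `L_ℝ`. It is computed from some
periodic realization; by `muRealization_eq_mu` every realization gives the same value, and by
`mu_eq_tmul` the value is the translation `t(p) - s(p) ∈ L` of any lift `p` of `q`. -/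
noncomputable def mu (q : List (AddAction.orbitRel.Quotient L E)) : ℝ ⊗[ℤ] L :=
  Γ.muRealization Γ.exists_isRealization.choose_spec q

theorem muRealization_map {Φ : V → ℝ ⊗[ℤ] L} (hΦ : Γ.IsRealization Φ) (p : List E) (x y : V)
    (h : Γ.IsWalk x p y) : Γ.muRealization hΦ (p.map (orbitClass L)) = Φ y - Φ x := by
  induction p generalizing x with
  | nil =>
    obtain rfl : x = y := h
    simp [muRealization]
  | cons e p ih =>
    obtain ⟨rfl, h⟩ := h
    have := ih _ h
    simp only [muRealization, List.map_cons, List.sum_cons] at this ⊢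
    rw [this]
    change Φ (Γ.t e) - Φ (Γ.s e) + _ = _
    abel

theorem mu_eq_tmul (p : List E) (x : V) (u : L) (h : Γ.IsWalk x p (u +ᵥ x)) :
    Γ.mu (p.map (orbitClass L)) = (1 : ℝ) ⊗ₜ[ℤ] u := by
  rw [mu, Γ.muRealization_map _ _ _ _ h, Γ.exists_isRealization.choose_spec u x]
  abel

theorem exists_lift (q : List (AddAction.orbitRel.Quotient L E)) (x : V)
    (z : AddAction.orbitRel.Quotient L V) (h : Γ.quot.IsWalk (orbitClass L x) q z) :
    ∃ p y, Γ.IsWalk x p y ∧ p.map (orbitClass L) = q ∧ orbitClass L y = z := by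
  induction q generalizing x with
  | nil => exact ⟨[], x, rfl, rfl, h⟩
  | cons e q ih =>
    obtain ⟨e, rfl⟩ := Quotient.exists_rep e
    obtain ⟨h1, h⟩ := h
    obtain ⟨u, hu⟩ := orbitClass_eq_iff.1 (show orbitClass L x = orbitClass L (Γ.s e) from h1.symm)
    have h2 : orbitClass L (u +ᵥ e) = orbitClass L e := orbitClass_eq_iff.2 ⟨u, rfl⟩
    have h3 : orbitClass L (Γ.t (u +ᵥ e)) = orbitClass L (Γ.t e) := by
      rw [Γ.t_vadd]; exact orbitClass_eq_iff.2 ⟨u, rfl⟩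
    obtain ⟨p, y, hp, rfl, hy⟩ := ih (Γ.t (u +ᵥ e)) (by rw [h3]; exact h)
    exact ⟨(u +ᵥ e) :: p, y, ⟨by rw [Γ.s_vadd, hu], hp⟩, by rw [List.map_cons, h2]; rfl, hy⟩

theorem muRealization_eq_mu {Φ : V → ℝ ⊗[ℤ] L} (hΦ : Γ.IsRealization Φ)
    (q : List (AddAction.orbitRel.Quotient L E)) (z : AddAction.orbitRel.Quotient L V)
    (h : Γ.quot.IsWalk z q z) : Γ.muRealization hΦ q = Γ.mu q := by
  obtain ⟨x, rfl⟩ := Quotient.exists_rep z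
  obtain ⟨p, y, hp, rfl, hy⟩ := Γ.exists_lift q x _ h
  obtain ⟨u, rfl⟩ := orbitClass_eq_iff.1 (show orbitClass L y = orbitClass L x from hy)
  rw [Γ.mu_eq_tmul p x u hp, Γ.muRealization_map hΦ p x _ hp, hΦ u x]
  abel

/-- The normalization map `ν(q) = μ(⟨q⟩) / w(q)`. -/
noncomputable def nu (q : List (AddAction.orbitRel.Quotient L E)) : ℝ ⊗[ℤ] L :=
  (Γ.quot.weight q : ℝ)⁻¹ • Γ.mu q

/-- The growth polytope `conv (ν(Cyc) ∪ {0})`. -/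
def growthPolytope : Set (ℝ ⊗[ℤ] L) :=
  convexHull ℝ (Γ.nu '' {q | Γ.quot.IsCycle q} ∪ {0})

theorem finite_cycles : {q | Γ.quot.IsCycle q}.Finite := by
  have := Γ.finite_V
  have := Γ.finite_E
  have := Fintype.ofFinite (AddAction.orbitRel.Quotient L V)
  refine (List.finite_length_le (AddAction.orbitRel.Quotient L E)
    (Fintype.card (AddAction.orbitRel.Quotient L V))).subset fun q hq => ?_
  have h := hq.2.2.length_le_card
  rwa [List.length_map] at h

theorem finite_vertices : ((Γ.growthPolytope).extremePoints ℝ \ {0}).Finite :=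
  (((Γ.finite_cycles.image Γ.nu).union (Set.finite_singleton 0)).subset
    extremePoints_convexHull_subset).sdiff

/-- The nonzero vertices of the growth polytope. -/
noncomputable def nonzeroVertices : Finset (ℝ ⊗[ℤ] L) := Γ.finite_vertices.toFinset

/-- `y` is `P`-initial: each nonzero vertex of the growth polytope is `ν` of a cycle through the
class of `y`. -/
def PInitial (y : V) : Prop :=
  ∀ v ∈ Γ.nonzeroVertices,
    ∃ q, Γ.quot.IsCycle q ∧ Γ.nu q = v ∧ orbitClass L y ∈ Γ.quot.supp q

theorem finite_out (x : V) : {e | Γ.s e = x}.Finite := by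
  have := Γ.finite_E
  refine Set.Finite.of_finite_image (f := orbitClass L) (Set.toFinite _) ?_
  intro a ha b hb hab
  obtain ⟨u, rfl⟩ := orbitClass_eq_iff.1 hab
  simp only [Set.mem_ofPred_eq, Γ.s_vadd] at ha hb
  rw [hb] at ha
  rw [Γ.free_V u x ha, zero_vadd]

theorem finite_walk_ends (n : ℕ) (x : V) :
    {y | ∃ p, Γ.IsWalk x p y ∧ p.length ≤ n}.Finite := by
  induction n generalizing x with
  | zero =>
    refine (Set.finite_singleton x).subset ?_
    rintro y ⟨p, hp, hl⟩
    obtain rfl := List.length_eq_zero_iff.1 (Nat.le_zero.1 hl)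
    exact Eq.symm hp
  | succ n ih =>
    refine ((Set.finite_singleton x).union
      ((Γ.finite_out x).biUnion fun e _ => ih (Γ.t e))).subset ?_
    rintro y ⟨_ | ⟨e, p⟩, hp, hl⟩
    · exact Or.inl (Eq.symm hp)
    · exact Or.inr (Set.mem_biUnion (x := e) hp.1 ⟨p, hp.2, Nat.le_of_succ_le_succ hl⟩)

theorem finite_sphere (x₀ : V) (i : ℕ) : (Γ.sphere x₀ i).Finite := by
  refine (Γ.finite_walk_ends i x₀).subset fun y hy => ?_
  have h1 : Γ.dist x₀ y < (i + 1 : ℕ) := by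
    rw [show Γ.dist x₀ y = i from hy]
    exact_mod_cast Nat.lt_succ_self i
  simp only [WGraph.dist, iInf_lt_iff] at h1
  obtain ⟨p, hp, hlt⟩ := h1
  refine ⟨p, hp, ?_⟩
  have h2 : Γ.weight p < i + 1 := by exact_mod_cast hlt
  have h3 : p.length ≤ Γ.weight p := by
    have := List.length_le_sum_of_one_le (p.map Γ.w) (by
      intro a ha
      obtain ⟨e, _, rfl⟩ := List.mem_map.1 ha
      exact Γ.w_pos e)
    rwa [List.length_map] at this
  omega

end PeriodicGraph

/-- `f` is a quasi-polynomial with `N` constituents `Q₀, …, Q_{N-1}`. -/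
def IsQuasiPolynomial (f : ℤ → ℂ) (N : ℕ) : Prop :=
  0 < N ∧ ∃ Q : Fin N → Polynomial ℂ, ∀ (n : ℤ) (i : Fin N),
    n ≡ (i : ℕ) [ZMOD N] → f n = (Q i).eval (n : ℂ)

/-- `N` is a quasi-period of `g`: `g` agrees with a quasi-polynomial with `N` constituents at all
sufficiently large integers. -/
def IsQuasiPeriod (g : ℕ → ℂ) (N : ℕ) : Prop :=
  ∃ f : ℤ → ℂ, IsQuasiPolynomial f N ∧ ∃ M : ℕ, ∀ n : ℕ, M < n → g n = f n

/-! Let `T ⊆ V × ℤ` be the set of pairs `(y, i)` with `d(x₀, y) ≤ i`; its generating function is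
`G(t) / (1 - t)`. A closed walk `q` through the class of `x₀` gives a translation
`(μ(q), w(q)) ∈ L × ℤ` that maps `T` into itself, and so does `(0, 1)`. A long walk from `x₀` passes
through some cycle `c` of `Γ / L` many times, and copies of `c` can be cut out of it. As `ν(c)` lies
in the convex hull of `0` and the `ν(q_v)`, some multiple of `(μ(c), w(c))` is a sum of copies of
`(0, 1)` and the `(μ(q_v), w(q_v))`. So every element of `T` of large degree is the translate of
another one by one of these generators: `T` is like a finitely generated module over a polynomial
ring, and its generating function is rational as in the Hilbert–Serre theorem.
-/

section Reaches

variable {A X : Type*} [AddCommMonoid A] [AddAction A X]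

/-- The preorder on `X` given by translation by the elements of a submonoid: divisibility, if `X` is
thought of as a set of monomials. -/
def Reaches (M : AddSubmonoid A) (x y : X) : Prop :=
  ∃ m ∈ M, m +ᵥ x = y

namespace Reaches

variable {M : AddSubmonoid A} {x y z : X}

theorem refl (M : AddSubmonoid A) (x : X) : Reaches M x x :=
  ⟨0, M.zero_mem, zero_vadd A x⟩

theorem trans : Reaches M x y → Reaches M y z → Reaches M x z := by
  rintro ⟨a, ha, rfl⟩ ⟨b, hb, rfl⟩
  exact ⟨b + a, M.add_mem hb ha, add_vadd b a x⟩

theorem vadd (u : A) : Reaches M x y → Reaches M (u +ᵥ x) (u +ᵥ y) := by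
  rintro ⟨a, ha, rfl⟩
  exact ⟨a, ha, vadd_comm a u x⟩

theorem mono {M' : AddSubmonoid A} (hM : M ≤ M') : Reaches M x y → Reaches M' x y :=
  fun ⟨a, ha, h⟩ => ⟨a, hM ha, h⟩

theorem sup_multiples_cases {u : A} (h : Reaches (M ⊔ .multiples u) x y) :
    Reaches M x y ∨ ∃ z, Reaches (M ⊔ .multiples u) x z ∧ u +ᵥ z = y := by
  obtain ⟨_, hsup, rfl⟩ := h
  obtain ⟨m, hm, _, ⟨n, rfl⟩, rfl⟩ := AddSubmonoid.mem_sup.1 hsup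
  cases n with
  | zero => exact .inl ⟨m, hm, by simp⟩
  | succ n =>
    refine .inr ⟨(m + n • u) +ᵥ x, ⟨m + n • u, ?_, rfl⟩, ?_⟩
    · exact AddSubmonoid.mem_sup.2 ⟨m, hm, n • u, ⟨n, rfl⟩, rfl⟩
    · rw [vadd_vadd]
      congr 1
      simp only [succ_nsmul]
      abel

end Reaches

/-- `T` is order convex for `Reaches M`; such sets play the role of subquotients of modules over
the monoid ring of `M`. -/
def ReachConvex (M : AddSubmonoid A) (T : Set X) : Prop :=
  ∀ ⦃x y z⦄, x ∈ T → z ∈ T → Reaches M x y → Reaches M y z → y ∈ T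

theorem ReachConvex.anti {M M' : AddSubmonoid A} {T : Set X} (hM : M ≤ M')
    (hT : ReachConvex M' T) : ReachConvex M T :=
  fun _ _ _ hx hz hxy hyz => hT hx hz (hxy.mono hM) (hyz.mono hM)

/-- Dickson's lemma. -/
theorem partiallyWellOrderedOn_reaches_closure {ι : Type*} (g : ι → A) (S : Finset ι) {T F : Set X}
    (hF : F.Finite) (hT : ∀ x ∈ T, ∃ y ∈ F, Reaches (.closure (g '' S)) y x) :
    T.PartiallyWellOrderedOn (Reaches (.closure (g '' S))) := by
  let f : (S →₀ ℕ) →ₗ[ℕ] A := Finsupp.linearCombination ℕ fun s : S => g s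
  have hf : ∀ m, m ∈ AddSubmonoid.closure (g '' S) ↔ ∃ a, m = f a := fun m => by
    rw [Set.image_eq_range]
    exact AddSubmonoid.mem_closure_range_iff
  have hprod : ((Set.univ : Set (S →₀ ℕ)) ×ˢ F).PartiallyWellOrderedOn
      fun p q => p.1 ≤ q.1 ∧ p.2 = q.2 :=
    Set.PartiallyWellOrderedOn.prod (Set.isPWO_of_wellQuasiOrderedLE _)
      hF.partiallyWellOrderedOn
  refine (hprod.image_of_monotone_on (f := fun p => f p.1 +ᵥ p.2) ?_).mono ?_
  · rintro ⟨a, x⟩ - ⟨b, _⟩ - ⟨hab, rfl⟩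
    refine ⟨f (b - a), (hf _).2 ⟨_, rfl⟩, ?_⟩
    rw [vadd_vadd, ← map_add, tsub_add_cancel_of_le hab]
  · intro x hx
    obtain ⟨y, hy, m, hm, rfl⟩ := hT x hx
    obtain ⟨a, rfl⟩ := (hf m).1 hm
    exact ⟨(a, y), ⟨trivial, hy⟩, rfl⟩

end Reaches

section TranslationSubmonoid

/-- The translations that map `T` into itself. -/
def translationSubmonoid (A : Type*) {X : Type*} [AddMonoid A] [AddAction A X] (T : Set X) :
    AddSubmonoid A where
  carrier := {m | ∀ x ∈ T, m +ᵥ x ∈ T}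
  zero_mem' x hx := by rwa [zero_vadd]
  add_mem' ha hb x hx := by rw [add_vadd]; exact ha _ (hb x hx)

theorem exists_neg_vadd_mem_of_mem_closure {A X : Type*} [AddGroup A] [AddAction A X]
    {G : Set A} {T : Set X} (hG : ∀ a ∈ G, a ∈ translationSubmonoid A T) {m : A}
    (hm : m ∈ AddSubmonoid.closure G) (hm₀ : m ≠ 0) {x : X} (hx : x ∈ T) :
    ∃ a ∈ G, -a +ᵥ (m +ᵥ x) ∈ T := by
  obtain ⟨a, ha, m', hm', rfl⟩ : ∃ a ∈ G, ∃ m' ∈ AddSubmonoid.closure G, a + m' = m := by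
    induction hm using AddSubmonoid.closure_induction_left with
    | zero => exact absurd rfl hm₀
    | add_left a ha m' hm' _ => exact ⟨a, ha, m', hm', rfl⟩
  refine ⟨a, ha, ?_⟩
  rw [vadd_vadd, neg_add_cancel_left]
  exact AddSubmonoid.closure_le.2 hG hm' x hx

theorem exists_common_nsmul_mem {A : Type*} [AddMonoid A] {M : AddSubmonoid A} {S : Set A}
    (hS : S.Finite) (h : ∀ a ∈ S, ∃ N : ℕ, 0 < N ∧ N • a ∈ M) :
    ∃ N : ℕ, 0 < N ∧ ∀ a ∈ S, N • a ∈ M := by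
  choose! N hN hmem using h
  refine ⟨∏ a ∈ hS.toFinset, N a, ?_, fun a ha => ?_⟩
  · exact Finset.prod_pos fun a ha => hN a (hS.mem_toFinset.1 ha)
  · obtain ⟨k, hk⟩ := Finset.dvd_prod_of_mem N (hS.mem_toFinset.2 ha)
    rw [hk, mul_nsmul]
    exact nsmul_mem (hmem a ha) k

end TranslationSubmonoid

section HilbertSeries

open scoped Pointwise

variable {A X : Type*} [AddCommGroup A] [AddAction A X]

namespace ReachConvex

variable {M : AddSubmonoid A} {T : Set X} {u : A}

theorem sdiff_vadd (hT : ReachConvex M T) (hu : u ∈ M) : ReachConvex M (T \ (u +ᵥ T)) := by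
  intro x y z hx hz hxy hyz
  refine ⟨hT hx.1 hz.1 hxy hyz, fun hy => hz.2 ?_⟩
  rw [Set.mem_vadd_set_iff_neg_vadd_mem] at hy ⊢
  exact hT hy hz.1 (hyz.vadd (-u)) ⟨u, hu, vadd_neg_vadd u z⟩

theorem sdiff_neg_vadd (hT : ReachConvex M T) (hu : u ∈ M) : ReachConvex M (T \ (-u +ᵥ T)) := by
  intro x y z hx hz hxy hyz
  refine ⟨hT hx.1 hz.1 hxy hyz, fun hy => hx.2 ?_⟩
  rw [Set.mem_vadd_set_iff_neg_vadd_mem, neg_neg] at hy ⊢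
  exact hT hx.1 hy ⟨u, hu, rfl⟩ (hxy.vadd u)

theorem reaches_of_sdiff_vadd (hT : ReachConvex (M ⊔ .multiples u) T) {x y : X} (hx : x ∈ T)
    (hy : y ∈ T \ (u +ᵥ T)) (h : Reaches (M ⊔ .multiples u) x y) : Reaches M x y := by
  have hu : u ∈ M ⊔ .multiples u := AddSubmonoid.mem_sup_right (AddSubmonoid.mem_multiples u)
  refine h.sup_multiples_cases.resolve_right ?_
  rintro ⟨z, hxz, rfl⟩
  exact hy.2 (Set.vadd_mem_vadd_set (hT hx hy.1 hxz ⟨u, hu, rfl⟩))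

theorem reaches_of_sdiff_neg_vadd (hT : ReachConvex (M ⊔ .multiples u) T) {x y : X}
    (hx : x ∈ T \ (-u +ᵥ T)) (hy : y ∈ T) (h : Reaches (M ⊔ .multiples u) x y) :
    Reaches M x y := by
  have hu : u ∈ M ⊔ .multiples u := AddSubmonoid.mem_sup_right (AddSubmonoid.mem_multiples u)
  refine h.sup_multiples_cases.resolve_right ?_
  rintro ⟨z, hxz, rfl⟩
  refine hx.2 (Set.mem_vadd_set_iff_neg_vadd_mem.2 ?_)
  rw [neg_neg]
  exact hT hx.1 hy ⟨u, hu, rfl⟩ (hxz.vadd u)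

end ReachConvex

/-- The condition under which `T`, graded by `deg`, has a Hilbert series. -/
structure IsFinitelyGraded (deg : X → ℤ) (T : Set X) : Prop where
  nonneg : ∀ x ∈ T, 0 ≤ deg x
  finite_fiber : ∀ i, {x ∈ T | deg x = i}.Finite

theorem IsFinitelyGraded.mono {deg : X → ℤ} {T U : Set X} (hU : IsFinitelyGraded deg U)
    (h : T ⊆ U) : IsFinitelyGraded deg T where
  nonneg x hx := hU.nonneg x (h hx)
  finite_fiber i := (hU.finite_fiber i).subset fun _ hx => ⟨h hx.1, hx.2⟩

theorem IsFinitelyGraded.finite_lt {deg : X → ℤ} {T : Set X} (hT : IsFinitelyGraded deg T)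
    (K : ℤ) : {x ∈ T | deg x < K}.Finite :=
  ((Set.finite_Ico 0 K).biUnion fun i _ => hT.finite_fiber i).subset fun x hx =>
    Set.mem_biUnion (x := deg x) ⟨hT.nonneg x hx.1, hx.2⟩ ⟨hx.1, rfl⟩

/-- The generating function `∑ #{x ∈ T | deg x = i} tⁱ`. It ignores the elements of negative
degree, and an infinite fiber contributes `0`. -/
noncomputable def hilbertSeries (deg : X → ℤ) (T : Set X) : PowerSeries ℤ :=
  PowerSeries.mk fun i => ({x ∈ T | deg x = i}.ncard : ℤ)

theorem exists_hilbertSeries_eq_coe (deg : X → ℤ) {T : Set X} (hT : T.Finite) :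
    ∃ Q : Polynomial ℤ, hilbertSeries deg T = Q := by
  obtain ⟨B, hB⟩ := (hT.image deg).bddAbove
  refine ⟨(hilbertSeries deg T).trunc (B.toNat + 1), ?_⟩
  ext i
  rw [Polynomial.coeff_coe, PowerSeries.coeff_trunc]
  split_ifs with hi
  · rfl
  · have hempty : {x ∈ T | deg x = i} = ∅ := by
      refine Set.eq_empty_of_forall_notMem fun x ⟨hx, hdeg⟩ => ?_
      have := hB (Set.mem_image_of_mem deg hx)
      omega
    rw [hilbertSeries, PowerSeries.coeff_mk, hempty, Set.ncard_empty, Nat.cast_zero]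

theorem hilbertSeries_inter_add_sdiff {deg : X → ℤ} {T : Set X} (hT : IsFinitelyGraded deg T)
    (U : Set X) : hilbertSeries deg (T ∩ U) + hilbertSeries deg (T \ U) = hilbertSeries deg T := by
  ext i
  simp only [hilbertSeries, map_add, PowerSeries.coeff_mk]
  rw [← Set.ncard_inter_add_ncard_sdiff_eq_ncard _ U (hT.finite_fiber i), Nat.cast_add]
  congr 3 <;> ext x <;> simp only [Set.mem_inter_iff, Set.mem_sdiff, Set.mem_ofPred_eq] <;> tauto

theorem IsFinitelyGraded.vadd {deg : X → ℤ} {T : Set X} (hT : IsFinitelyGraded deg T) {u : A}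
    {d : ℕ} (hu : ∀ x, deg (u +ᵥ x) = deg x + d) : IsFinitelyGraded deg (u +ᵥ T) where
  nonneg := by
    rintro _ ⟨x, hx, rfl⟩
    have := hT.nonneg x hx
    have := hu x
    dsimp only
    omega
  finite_fiber i := ((hT.finite_fiber (i - d)).image (u +ᵥ ·)).subset <| by
    rintro _ ⟨⟨x, hx, rfl⟩, hi⟩
    exact ⟨x, ⟨hx, by rw [← hi, hu, add_sub_cancel_right]⟩, rfl⟩

theorem hilbertSeries_vadd {deg : X → ℤ} {T : Set X} (hT : ∀ x ∈ T, 0 ≤ deg x)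
    {u : A} {d : ℕ} (hu : ∀ x, deg (u +ᵥ x) = deg x + d) :
    hilbertSeries deg (u +ᵥ T) = PowerSeries.X ^ d * hilbertSeries deg T := by
  ext i
  have hfiber : {x ∈ u +ᵥ T | deg x = i} = u +ᵥ {x ∈ T | deg x = i - d} := by
    ext x
    have := hu (-u +ᵥ x)
    rw [vadd_neg_vadd] at this
    simp only [Set.mem_ofPred_eq, Set.mem_vadd_set_iff_neg_vadd_mem, this, eq_sub_iff_add_eq]
  rw [PowerSeries.coeff_X_pow_mul']
  simp only [hilbertSeries, PowerSeries.coeff_mk, hfiber, Set.ncard_vadd_set]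
  split_ifs with hdi
  · rw [Nat.cast_sub hdi]
  · have hempty : {x ∈ T | deg x = (i : ℤ) - d} = ∅ := by
      refine Set.eq_empty_of_forall_notMem fun x ⟨hx, hdeg⟩ => ?_
      have := hT x hx
      omega
    rw [hempty, Set.ncard_empty, Nat.cast_zero]

/-- The combinatorial shadow of the exact sequence given by the kernel and the cokernel of
multiplication by a homogeneous element. -/
theorem hilbertSeries_mul_one_sub_X_pow {deg : X → ℤ} {T : Set X} (hT : IsFinitelyGraded deg T)
    {u : A} {d : ℕ} (hu : ∀ x, deg (u +ᵥ x) = deg x + d) :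
    hilbertSeries deg T * (1 - PowerSeries.X ^ d) =
      hilbertSeries deg (T \ (u +ᵥ T)) -
        PowerSeries.X ^ d * hilbertSeries deg (T \ (-u +ᵥ T)) := by
  have hker : (u +ᵥ T) \ T = u +ᵥ (T \ (-u +ᵥ T)) := by
    rw [Set.vadd_set_sdiff, vadd_neg_vadd]
  have hT' := hilbertSeries_inter_add_sdiff hT (u +ᵥ T)
  have huT := hilbertSeries_inter_add_sdiff (hT.vadd hu) T
  rw [hker, hilbertSeries_vadd hT.nonneg hu, hilbertSeries_vadd (fun x hx => hT.nonneg x hx.1) hu,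
    Set.inter_comm] at huT
  linear_combination huT - hT'

/-- The Hilbert–Serre theorem for graded sets, well-quasi-ordering taking the place of
Noetherianity. -/
theorem exists_hilbertSeries_mul_prod {ι : Type*} (g : ι → A) (d : ι → ℕ) {deg : X → ℤ}
    (hdeg : ∀ s x, deg (g s +ᵥ x) = deg x + d s) (S : Finset ι) {T : Set X}
    (hT : IsFinitelyGraded deg T) (hconv : ReachConvex (.closure (g '' S)) T)
    (hpwo : T.PartiallyWellOrderedOn (Reaches (.closure (g '' S)))) :
    ∃ Q : Polynomial ℤ,
      hilbertSeries deg T * ∏ s ∈ S, (1 - PowerSeries.X ^ d s) = (Q : PowerSeries ℤ) := by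
  classical
  induction S using Finset.induction_on generalizing T with
  | empty =>
    have hfin : T.Finite := by
      refine IsAntichain.finite_of_partiallyWellOrderedOn ?_ hpwo
      rintro x - y - hxy ⟨m, hm, rfl⟩
      rw [Finset.coe_empty, Set.image_empty, AddSubmonoid.closure_empty,
        AddSubmonoid.mem_bot] at hm
      exact hxy (by rw [hm, zero_vadd])
    simpa using exists_hilbertSeries_eq_coe deg hfin
  | insert s S hs ih =>
    set M := AddSubmonoid.closure (g '' S)
    have hclosure : AddSubmonoid.closure (g '' (insert s S : Finset ι)) = M ⊔ .multiples (g s) := by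
      rw [Finset.coe_insert, Set.image_insert_eq, Set.insert_eq, AddSubmonoid.closure_union,
        AddSubmonoid.closure_singleton_eq, sup_comm, AddSubmonoid.multiples_eq_closure,
        AddSubmonoid.closure_singleton_eq]
    rw [hclosure] at hconv hpwo
    have hgs : g s ∈ M ⊔ .multiples (g s) :=
      AddSubmonoid.mem_sup_right (AddSubmonoid.mem_multiples _)
    have hpwo' {U : Set X} (hUT : U ⊆ T)
        (hU : ∀ x ∈ U, ∀ y ∈ U, Reaches (M ⊔ .multiples (g s)) x y → Reaches M x y) :
        U.PartiallyWellOrderedOn (Reaches M) := by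
      simpa only [Set.image_id] using (hpwo.mono hUT).image_of_monotone_on (f := id) hU
    obtain ⟨Q₁, hQ₁⟩ := ih (hT.mono Set.sdiff_subset)
      ((hconv.sdiff_vadd hgs).anti le_sup_left)
      (hpwo' Set.sdiff_subset fun x hx y hy => hconv.reaches_of_sdiff_vadd hx.1 hy)
    obtain ⟨Q₂, hQ₂⟩ := ih (hT.mono Set.sdiff_subset)
      ((hconv.sdiff_neg_vadd hgs).anti le_sup_left)
      (hpwo' Set.sdiff_subset fun x hx y hy => hconv.reaches_of_sdiff_neg_vadd hx hy.1)
    refine ⟨Q₁ - Polynomial.X ^ d s * Q₂, ?_⟩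
    rw [Finset.prod_insert hs, ← mul_assoc, hilbertSeries_mul_one_sub_X_pow hT (hdeg s), sub_mul,
      hQ₁, mul_assoc, hQ₂, Polynomial.coe_sub, Polynomial.coe_mul, Polynomial.coe_pow,
      Polynomial.coe_X]

theorem exists_reaches_of_descent {ι : Type*} (g : ι → A) {d : ι → ℕ} {deg : X → ℤ}
    (hdeg : ∀ s x, deg (g s +ᵥ x) = deg x + d s) {S : Set ι} (hd : ∀ s ∈ S, 0 < d s)
    {T : Set X} (hT : ∀ x ∈ T, 0 ≤ deg x) {K : ℤ}
    (hK : ∀ x ∈ T, K ≤ deg x → ∃ s ∈ S, -g s +ᵥ x ∈ T) :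
    ∀ x ∈ T, ∃ y ∈ {x ∈ T | deg x < K}, Reaches (.closure (g '' S)) y x := by
  intro x hx
  induction hn : (deg x).toNat using Nat.strong_induction_on generalizing x with
  | _ n ih =>
    rcases lt_or_ge (deg x) K with hlt | hge
    · exact ⟨x, ⟨hx, hlt⟩, .refl _ x⟩
    · obtain ⟨s, hs, hy⟩ := hK x hx hge
      have hdegx := hdeg s (-g s +ᵥ x)
      rw [vadd_neg_vadd] at hdegx
      have := hd s hs
      have := hT _ hy
      obtain ⟨z, hz, hzy⟩ := ih _ (by omega) _ hy rfl
      exact ⟨z, hz, hzy.trans ⟨g s, AddSubmonoid.subset_closure ⟨s, hs, rfl⟩, vadd_neg_vadd _ _⟩⟩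

theorem exists_hilbertSeries_mul_prod_of_descent {ι : Type*} (g : ι → A) (d : ι → ℕ) {deg : X → ℤ}
    (hdeg : ∀ s x, deg (g s +ᵥ x) = deg x + d s) (S : Finset ι) (hd : ∀ s ∈ S, 0 < d s)
    {T : Set X} (hT : IsFinitelyGraded deg T) (hg : ∀ s ∈ S, g s ∈ translationSubmonoid A T)
    {K : ℤ} (hK : ∀ x ∈ T, K ≤ deg x → ∃ s ∈ S, -g s +ᵥ x ∈ T) :
    ∃ Q : Polynomial ℤ,
      hilbertSeries deg T * ∏ s ∈ S, (1 - PowerSeries.X ^ d s) = (Q : PowerSeries ℤ) := by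
  have hstable : AddSubmonoid.closure (g '' S) ≤ translationSubmonoid A T :=
    AddSubmonoid.closure_le.2 (Set.image_subset_iff.2 hg)
  refine exists_hilbertSeries_mul_prod g d hdeg S hT ?_ ?_
  · rintro x _ z hx - ⟨m, hm, rfl⟩ -
    exact hstable hm x hx
  · exact partiallyWellOrderedOn_reaches_closure g S (hT.finite_lt K)
      (exists_reaches_of_descent g hdeg hd hT.nonneg hK)

end HilbertSeries

section QuasiPeriod

variable {R : Type*} [CommRing R]

/-- The power series formed by the coefficients of `F` in the residue class `r` modulo `N`. -/
noncomputable def multisection (N r : ℕ) (F : PowerSeries R) : PowerSeries R :=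
  PowerSeries.mk fun m => PowerSeries.coeff (N * m + r) F

theorem multisection_mul_one_sub_X_pow {N r : ℕ} (hr : r < N) (F : PowerSeries R) :
    multisection N r (F * (1 - PowerSeries.X ^ N)) =
      multisection N r F * (1 - PowerSeries.X) := by
  ext m
  rw [mul_sub, mul_sub, mul_one, mul_one, map_sub]
  simp only [multisection, PowerSeries.coeff_mk, map_sub, PowerSeries.coeff_mul_X_pow']
  congr 1
  cases m with
  | zero => simp [hr]
  | succ m =>
    rw [PowerSeries.coeff_succ_mul_X, PowerSeries.coeff_mk, Nat.mul_succ, if_pos (by lia)]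
    congr 2
    lia

theorem multisection_mul_one_sub_X_pow_pow {N r : ℕ} (hr : r < N) (k : ℕ) (F : PowerSeries R) :
    multisection N r (F * (1 - PowerSeries.X ^ N) ^ k) =
      multisection N r F * (1 - PowerSeries.X) ^ k := by
  induction k with
  | zero => simp
  | succ k ih =>
    rw [pow_succ, ← mul_assoc, multisection_mul_one_sub_X_pow hr, ih, pow_succ, mul_assoc]

theorem exists_multisection_eq_coe {N : ℕ} (hN : 0 < N) (r : ℕ) (Q : Polynomial R) :
    ∃ P : Polynomial R, multisection N r (Q : PowerSeries R) = P := by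
  refine ⟨(multisection N r (Q : PowerSeries R)).trunc (Q.natDegree + 1), ?_⟩
  ext m
  rw [Polynomial.coeff_coe, PowerSeries.coeff_trunc]
  split_ifs with hm
  · rfl
  · rw [multisection, PowerSeries.coeff_mk, Polynomial.coeff_coe]
    apply Polynomial.coeff_eq_zero_of_natDegree_lt
    have := Nat.le_mul_of_pos_left m hN
    lia

theorem IsQuasiPeriod.of_section_eq_eval {a : ℕ → ℂ} {N : ℕ} (hN : 0 < N)
    (h : ∀ r < N, ∃ P : Polynomial ℂ, ∀ᶠ m : ℕ in Filter.atTop, a (N * m + r) = P.eval (m : ℂ)) :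
    IsQuasiPeriod a N := by
  choose! P hP using h
  let residue (n : ℤ) : ℕ := (n % N).toNat
  refine ⟨fun n => (P (residue n)).eval (((n : ℂ) - residue n) / N), ⟨hN, fun r =>
    (P r).comp (Polynomial.C (N : ℂ)⁻¹ * (Polynomial.X - Polynomial.C (r : ℂ))), ?_⟩, ?_⟩
  · intro n r hr
    have hres : residue n = r := by
      have hr' : n % N = ((r : ℕ) : ℤ) % N := hr
      simp only [residue, hr', ← Int.natCast_mod, Nat.mod_eq_of_lt r.2, Int.toNat_natCast]
    simp only [hres, Polynomial.eval_comp, Polynomial.eval_mul, Polynomial.eval_C,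
      Polynomial.eval_sub, Polynomial.eval_X, div_eq_inv_mul]
  · obtain ⟨M, hM⟩ := Filter.eventually_atTop.1 <|
      (Filter.eventually_all_finset (Finset.range N)).2 fun r hr => hP r (Finset.mem_range.1 hr)
    refine ⟨N * M, fun n hn => ?_⟩
    have hres : residue n = n % N := by
      simp only [residue, ← Int.natCast_mod, Int.toNat_natCast]
    have hquot : M ≤ n / N := (Nat.le_div_iff_mul_le hN).2 (by lia)
    have hdiv : ((n : ℂ) - (n % N : ℕ)) / N = (n / N : ℕ) := by
      rw [div_eq_iff (by exact_mod_cast hN.ne'), sub_eq_iff_eq_add]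
      exact_mod_cast (Nat.div_add_mod' n N).symm
    have := hM _ hquot _ (Finset.mem_range.2 (Nat.mod_lt n hN))
    rw [Nat.div_add_mod] at this
    simp only [hres, Int.cast_natCast, hdiv, this]

theorem IsQuasiPeriod.of_mul_one_sub_X_pow_pow {a : ℕ → ℂ} {N k : ℕ} (hN : 0 < N)
    {Q : Polynomial ℂ} (h : PowerSeries.mk a * (1 - PowerSeries.X ^ N) ^ k = (Q : PowerSeries ℂ)) :
    IsQuasiPeriod a N := by
  refine .of_section_eq_eval hN fun r hr => ?_
  obtain ⟨P, hP⟩ := exists_multisection_eq_coe hN r Q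
  rw [← h, multisection_mul_one_sub_X_pow_pow hr] at hP
  have hsection : multisection N r (PowerSeries.mk a) =
      P * (PowerSeries.invOneSubPow ℂ k : PowerSeries ℂ) := by
    rw [← hP, mul_assoc, ← PowerSeries.invOneSubPow_inv_eq_one_sub_pow, Units.inv_val, mul_one]
  refine ⟨P.hilbertPoly k, (Filter.eventually_gt_atTop P.natDegree).mono fun m hm => ?_⟩
  rw [← Polynomial.coeff_mul_invOneSubPow_eq_hilbertPoly_eval k hm, ← hsection]
  simp only [multisection, PowerSeries.coeff_mk]

theorem one_sub_X_pow_dvd {w N : ℕ} (h : w ∣ N) :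
    (1 - Polynomial.X ^ w : Polynomial R) ∣ 1 - Polynomial.X ^ N := by
  obtain ⟨c, rfl⟩ := h
  rw [pow_mul]
  simpa only [one_pow] using sub_dvd_pow_sub_pow (1 : Polynomial R) (Polynomial.X ^ w) c

theorem exists_mul_one_sub_X_pow_pow_of_mul_prod {ι : Type*} {F : PowerSeries R} {N : ℕ}
    (S : Finset ι) (w : ι → ℕ) (hw : ∀ s ∈ S, w s ∣ N) {Q : Polynomial R}
    (h : F * ∏ s ∈ S, (1 - PowerSeries.X ^ w s) = (Q : PowerSeries R)) :
    ∃ P : Polynomial R, F * (1 - PowerSeries.X ^ N) ^ S.card = (P : PowerSeries R) := by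
  have hdvd : (∏ s ∈ S, (1 - Polynomial.X ^ w s) : Polynomial R) ∣
      (1 - Polynomial.X ^ N) ^ S.card := by
    rw [← Finset.prod_const]
    exact Finset.prod_dvd_prod_of_dvd _ _ fun s hs => one_sub_X_pow_dvd (hw s hs)
  obtain ⟨D, hD⟩ := hdvd
  have hD' := congrArg (Polynomial.coeToPowerSeries.ringHom (R := R)) hD
  simp only [map_mul, map_prod, map_pow, map_sub, map_one,
    Polynomial.coeToPowerSeries.ringHom_apply, Polynomial.coe_X] at hD'
  exact ⟨Q * D, by rw [hD', ← mul_assoc, h, Polynomial.coe_mul]⟩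

theorem IsQuasiPeriod.of_mul_prod {ι : Type*} {a : ℕ → ℕ} {N : ℕ} (hN : 0 < N) (S : Finset ι)
    (w : ι → ℕ) (hw : ∀ s ∈ S, w s ∣ N) {Q : Polynomial ℤ}
    (h : PowerSeries.mk (fun i => (a i : ℤ)) * ∏ s ∈ S, (1 - PowerSeries.X ^ w s) =
      (Q : PowerSeries ℤ)) :
    IsQuasiPeriod (fun i => (a i : ℂ)) N := by
  obtain ⟨P, hP⟩ := exists_mul_one_sub_X_pow_pow_of_mul_prod S w hw h
  refine .of_mul_one_sub_X_pow_pow (k := S.card) (Q := P.map (Int.castRingHom ℂ)) hN ?_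
  have hmk : PowerSeries.mk (fun i => (a i : ℂ)) =
      PowerSeries.map (Int.castRingHom ℂ) (PowerSeries.mk fun i => (a i : ℤ)) := by
    ext i
    simp
  rw [Polynomial.polynomial_map_coe, ← hP, hmk]
  simp only [map_mul, map_pow, map_sub, map_one, PowerSeries.map_X]

end QuasiPeriod

section ExtremePoints

variable {F : Type*} [AddCommGroup F] [Module ℝ F] {S : Set F} {x : F}

theorem mem_extremePoints_convexHull_insert (hx : x ∉ convexHull ℝ S) :
    x ∈ (convexHull ℝ (insert x S)).extremePoints ℝ := by
  rcases S.eq_empty_or_nonempty with rfl | hS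
  · simp
  rw [(convex_convexHull ℝ _).mem_extremePoints_iff_convex_sdiff]
  refine ⟨subset_convexHull ℝ _ (Set.mem_insert x S), ?_⟩
  have mem_iff (p : F) : p ∈ convexHull ℝ (insert x S) \ {x} ↔
      ∃ y ∈ convexHull ℝ S, ∃ s : ℝ, 0 < s ∧ s ≤ 1 ∧ p = x + s • (y - x) := by
    rw [convexHull_insert hS, convexJoin_singleton_left]
    simp only [Set.mem_sdiff, Set.mem_iUnion₂, Set.mem_singleton_iff, segment_eq_image']
    constructor
    · rintro ⟨⟨y, hy, s, ⟨hs₀, hs₁⟩, rfl⟩, hne⟩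
      exact ⟨y, hy, s, hs₀.lt_of_ne (by rintro rfl; simp at hne), hs₁, rfl⟩
    · rintro ⟨y, hy, s, hs₀, hs₁, rfl⟩
      refine ⟨⟨y, hy, s, ⟨hs₀.le, hs₁⟩, rfl⟩, fun h => hx ?_⟩
      have : y - x = 0 := by simpa [hs₀.ne'] using h
      rwa [← sub_eq_zero.1 this]
  intro p hp q hq a b ha hb hab
  rw [mem_iff] at hp hq ⊢
  obtain ⟨y, hy, s, hs₀, hs₁, rfl⟩ := hp
  obtain ⟨z, hz, t, ht₀, ht₁, rfl⟩ := hq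
  have hpos : 0 < a * s + b * t := by
    rcases ha.eq_or_lt with rfl | ha
    · rw [zero_add] at hab
      simpa [hab] using ht₀
    · positivity
  refine ⟨(a * s / (a * s + b * t)) • y + (b * t / (a * s + b * t)) • z,
    convex_convexHull ℝ S hy hz (by positivity) (by positivity) (by field_simp),
    a * s + b * t, hpos, by nlinarith, ?_⟩
  obtain rfl : b = 1 - a := by linarith
  match_scalars
  · field_simp
    ring
  · field_simp
  · field_simp

/-- Minkowski's theorem for polytopes, in a real vector space of arbitrary dimension. -/
theorem convexHull_extremePoints_convexHull (hS : S.Finite) :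
    convexHull ℝ ((convexHull ℝ S).extremePoints ℝ) = convexHull ℝ S := by
  obtain ⟨T, hTS, ⟨-, hT⟩, hmin⟩ := (hS.finite_subsets.inter_of_left
    {T | convexHull ℝ T = convexHull ℝ S}).exists_le_minimal
      ⟨subset_refl S, rfl⟩
  rw [← hT]
  refine (convexHull_min extremePoints_subset (convex_convexHull ℝ T)).antisymm
    (convexHull_mono fun x hxT => ?_)
  have hinsert : insert x (T \ {x}) = T := by
    rw [Set.insert_sdiff_singleton, Set.insert_eq_of_mem hxT]
  by_cases hx : x ∈ convexHull ℝ (T \ {x})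
  · have hhull : convexHull ℝ (T \ {x}) = convexHull ℝ S := by
      rw [← hT]
      refine (convexHull_mono Set.sdiff_subset).antisymm
        (convexHull_min ?_ (convex_convexHull ℝ _))
      nth_rw 1 [← hinsert]
      exact Set.insert_subset hx (subset_convexHull ℝ _)
    have := hmin ⟨Set.sdiff_subset.trans hTS, hhull⟩ Set.sdiff_subset hxT
    exact absurd rfl this.2
  · rw [← hinsert]
    exact mem_extremePoints_convexHull_insert hx

end ExtremePoints

section RationalCombination

variable {L : Type*} [AddCommGroup L]

theorem exists_nsmul_eq_zero_of_one_tmul_eq_zero {u : L} (hu : (1 : ℝ) ⊗ₜ[ℤ] u = 0) :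
    ∃ n : ℕ, 0 < n ∧ n • u = 0 := by
  let π := (Submodule.torsion ℤ L).mkQ
  have hinj := Module.Flat.rTensor_preserves_injective_linearMap
    (M := L ⧸ Submodule.torsion ℤ L) (Algebra.linearMap ℤ ℝ) Int.cast_injective
  have hπ : (1 : ℤ) ⊗ₜ[ℤ] π u = 0 := hinj <| by
    rw [LinearMap.rTensor_tmul, map_zero, Algebra.linearMap_apply, map_one,
      ← LinearMap.lTensor_tmul, hu, map_zero]
  have hmem : u ∈ Submodule.torsion ℤ L := by
    have := congrArg (TensorProduct.lid ℤ _) hπ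
    rwa [TensorProduct.lid_tmul, one_smul, map_zero, Submodule.mkQ_apply,
      Submodule.Quotient.mk_eq_zero] at this
  obtain ⟨n, hn⟩ := (Submodule.mem_torsion_iff u).1 hmem
  refine ⟨(n : ℤ).natAbs, Int.natAbs_pos.2 (nonZeroDivisors.ne_zero n.2), ?_⟩
  rw [natAbs_nsmul_eq_zero]
  exact hn

/-- A point of `L × ℤ` as a displacement with a duration; this is the corresponding velocity. -/
noncomputable def velocity (a : L × ℤ) : ℝ ⊗[ℤ] L :=
  (a.2 : ℝ)⁻¹ • (1 : ℝ) ⊗ₜ[ℤ] a.1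

theorem smul_velocity {a : L × ℤ} (ha : a.2 ≠ 0) :
    (a.2 : ℝ) • velocity a = (1 : ℝ) ⊗ₜ[ℤ] a.1 :=
  smul_inv_smul₀ (Int.cast_ne_zero.2 ha) _

theorem exists_rat_coeff {ι : Type*} [Fintype ι] {b : ι → L × ℤ}
    (hb : AffineIndependent ℝ (velocity ∘ b)) {c : ι → ℝ} (hc : ∑ i, c i = 1) {a : L × ℤ}
    (h : ∑ i, c i • velocity (b i) = velocity a) : ∃ r : ι → ℚ, ∀ i, c i = r i := by
  -- A `ℚ`-linear retraction of `ℚ ⊆ ℝ` maps `c` to a second solution of the same equations.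
  obtain ⟨ρ, hρ⟩ := LinearMap.exists_leftInverse_of_injective (Algebra.linearMap ℚ ℝ)
    (LinearMap.ker_eq_bot.2 (algebraMap ℚ ℝ).injective)
  have hρ_cast (r : ℚ) : ρ r = r := LinearMap.congr_fun hρ r
  let ρ' : ℝ →ₗ[ℤ] ℝ := ((Algebra.linearMap ℚ ℝ).comp ρ).restrictScalars ℤ
  have hρ' (x : ℝ) (a : L × ℤ) :
      LinearMap.rTensor L ρ' (x • velocity a) = (ρ x : ℝ) • velocity a := by
    have hx : x * (a.2 : ℝ)⁻¹ = (a.2 : ℚ)⁻¹ • x := by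
      rw [Rat.smul_def, mul_comm]
      push_cast
      rfl
    have hρx : ρ' (x * (a.2 : ℝ)⁻¹) = ρ x * (a.2 : ℝ)⁻¹ := by
      change ((ρ _ : ℚ) : ℝ) = _
      rw [hx, map_smul, smul_eq_mul, mul_comm]
      push_cast
      rfl
    simp only [velocity, TensorProduct.smul_tmul', smul_eq_mul, mul_one, LinearMap.rTensor_tmul,
      hρx]
  have hρc : ∑ i, (ρ (c i) : ℝ) = 1 := by
    rw [← Rat.cast_sum, ← map_sum, hc, ← Rat.cast_one, hρ_cast]
  have hρh : ∑ i, (ρ (c i) : ℝ) • velocity (b i) = velocity a := by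
    have := hρ' 1 a
    rw [one_smul, ← Rat.cast_one, hρ_cast, Rat.cast_one, one_smul] at this
    simpa only [← h, map_sum, hρ'] using this
  refine ⟨fun i => ρ (c i), fun i => sub_eq_zero.1 ?_⟩
  refine affineIndependent_iff.1 hb Finset.univ (fun i => c i - ρ (c i)) ?_ ?_ i (Finset.mem_univ i)
  · rw [Finset.sum_sub_distrib, hc, hρc, sub_self]
  · simp only [sub_smul, Finset.sum_sub_distrib, Function.comp_apply, h, hρh, sub_self]

theorem exists_common_denominator {ι : Type*} [Finite ι] (r : ι → ℚ≥0) :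
    ∃ N : ℕ, 0 < N ∧ ∃ k : ι → ℕ, ∀ i, N * r i = k i := by
  have := Fintype.ofFinite ι
  have hdvd (i : ι) : (r i).den ∣ ∏ j, (r j).den := Finset.dvd_prod_of_mem _ (Finset.mem_univ i)
  choose c hc using hdvd
  refine ⟨∏ j, (r j).den, Finset.prod_pos fun j _ => (r j).den_pos, fun i => c i * (r i).num,
    fun i => ?_⟩
  rw [hc i]
  push_cast
  rw [mul_right_comm, NNRat.den_mul_eq_num, mul_comm]

theorem exists_nsmul_mem_closure_range {ι : Type*} [Fintype ι] {b : ι → L × ℤ}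
    (hb : ∀ i, 0 < (b i).2) {r : ι → ℚ≥0} (hr : ∑ i, (r i : ℝ) = 1) {a : L × ℤ} (ha : 0 < a.2)
    (h : ∑ i, (r i : ℝ) • velocity (b i) = velocity a) :
    ∃ N : ℕ, 0 < N ∧ N • a ∈ AddSubmonoid.closure (Set.range b) := by
  obtain ⟨N, hN, k, hk⟩ := exists_common_denominator fun i => a.2.toNat * r i / (b i).2.toNat
  have hk' (i : ι) : (k i * (b i).2 : ℝ) = N * (a.2 * r i) := by
    have hbi : ((b i).2.toNat : ℝ) = (b i).2 := by exact_mod_cast Int.toNat_of_nonneg (hb i).le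
    have ha' : (a.2.toNat : ℝ) = a.2 := by exact_mod_cast Int.toNat_of_nonneg ha.le
    have hbi₀ : ((b i).2 : ℝ) ≠ 0 := by exact_mod_cast (hb i).ne'
    have hki : (N * (a.2.toNat * r i / (b i).2.toNat) : ℝ) = k i := by exact_mod_cast hk i
    rw [← hki, hbi, ha']
    field_simp
  have hsnd : N • a.2 = ∑ i, k i • (b i).2 := by
    have : (N * a.2 : ℝ) = ∑ i, (k i * (b i).2 : ℝ) := by
      simp only [hk', ← Finset.mul_sum, hr, mul_one]
    simp only [nsmul_eq_mul]
    exact_mod_cast this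
  have hfst : (1 : ℝ) ⊗ₜ[ℤ] (N • a.1 - ∑ i, k i • (b i).1) = 0 := by
    simp only [TensorProduct.tmul_sub, TensorProduct.tmul_sum, TensorProduct.tmul_smul,
      ← smul_velocity ha.ne', ← smul_velocity (hb _).ne', ← Nat.cast_smul_eq_nsmul ℝ, smul_smul,
      hk', ← h, Finset.smul_sum, sub_self]
  obtain ⟨n, hn, htors⟩ := exists_nsmul_eq_zero_of_one_tmul_eq_zero hfst
  refine ⟨n * N, Nat.mul_pos hn hN, ?_⟩
  have hsum : (n * N) • a = n • ∑ i, k i • b i := by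
    rw [mul_nsmul']
    ext
    · rw [smul_sub, sub_eq_zero] at htors
      simpa [Prod.fst_sum] using htors
    · simp only [Prod.smul_snd, hsnd, Prod.snd_sum]
  rw [hsum]
  exact nsmul_mem (sum_mem fun i _ => nsmul_mem
    (AddSubmonoid.subset_closure (Set.mem_range_self i)) _) _

theorem exists_nsmul_mem_closure {S : Set (L × ℤ)} (hS : ∀ b ∈ S, 0 < b.2) {a : L × ℤ}
    (ha : 0 < a.2) (h : velocity a ∈ convexHull ℝ (velocity '' S)) :
    ∃ N : ℕ, 0 < N ∧ N • a ∈ AddSubmonoid.closure S := by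
  obtain ⟨ι, _, z, c, hz, hind, hpos, hsum, hcomb⟩ := eq_pos_convex_span_of_mem_convexHull h
  choose b hbS hbz using Set.range_subset_iff.1 hz
  obtain rfl : velocity ∘ b = z := funext hbz
  obtain ⟨r, hr⟩ := exists_rat_coeff hind hsum hcomb
  lift r to ι → ℚ≥0 using fun i => by exact_mod_cast (hr i ▸ hpos i).le
  obtain rfl : c = fun i => (r i : ℝ) := funext fun i => (hr i).trans (by norm_cast)
  obtain ⟨N, hN, hmem⟩ := exists_nsmul_mem_closure_range (fun i => hS _ (hbS i)) hsum ha hcomb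
  exact ⟨N, hN, AddSubmonoid.closure_mono (Set.range_subset_iff.2 hbS) hmem⟩

end RationalCombination

theorem exists_replicate_sublist {α : Type*} (s : Finset α) {N : ℕ} {l : List α}
    (hl : ∀ x ∈ l, x ∈ s) (h : s.card * N < l.length) :
    ∃ x ∈ s, (List.replicate N x).Sublist l := by
  classical
  have hsum : ∑ x ∈ s, l.count x = l.length := by
    simpa using Multiset.sum_count_eq_card (s := s) (m := (l : Multiset α)) (by simpa using hl)
  obtain ⟨x, hx, hlt⟩ := Finset.exists_lt_of_sum_lt (s := s) (f := fun _ => N) (g := l.count) <| by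
    rwa [Finset.sum_const, smul_eq_mul, hsum]
  exact ⟨x, hx, List.replicate_sublist_iff.2 hlt.le⟩

namespace WGraph

variable {V E : Type*} {Γ : WGraph V E} {x y : V} {p q : List E}

theorem isWalk_append : Γ.IsWalk x (p ++ q) y ↔ ∃ z, Γ.IsWalk x p z ∧ Γ.IsWalk z q y := by
  induction p generalizing x with
  | nil => simp [IsWalk]
  | cons e p ih => simp [IsWalk, ih, and_assoc]

theorem IsWalk.unique {x' y' : V} (h : Γ.IsWalk x p y) (h' : Γ.IsWalk x' p y') (hp : p ≠ []) :
    x = x' ∧ y = y' := by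
  induction p generalizing x x' with
  | nil => exact absurd rfl hp
  | cons e p ih =>
    obtain ⟨rfl, h⟩ := h
    obtain ⟨rfl, h'⟩ := h'
    refine ⟨rfl, ?_⟩
    rcases eq_or_ne p [] with rfl | hp
    · exact Eq.trans (Eq.symm h) h'
    · exact (ih h h' hp).2

theorem IsCycle.eq_of_isWalk (hp : Γ.IsCycle p) (h : Γ.IsWalk x p y) : x = y := by
  obtain ⟨hne, ⟨z, hz⟩, -⟩ := hp
  obtain ⟨rfl, rfl⟩ := h.unique hz hne
  rfl

theorem weight_append (p q : List E) : Γ.weight (p ++ q) = Γ.weight p + Γ.weight q := by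
  simp [weight]

theorem length_le_weight (p : List E) : p.length ≤ Γ.weight p := by
  have := List.length_le_sum_of_one_le (p.map Γ.w) <| by
    intro a ha
    obtain ⟨e, -, rfl⟩ := List.mem_map.1 ha
    exact Γ.w_pos e
  rwa [List.length_map] at this

theorem weight_pos (hp : p ≠ []) : 0 < Γ.weight p :=
  (List.length_pos_iff.2 hp).trans_le (length_le_weight p)

theorem weight_le_mul_length {W : ℕ} (hW : ∀ e, Γ.w e ≤ W) (p : List E) :
    Γ.weight p ≤ W * p.length := by
  have := List.sum_le_card_nsmul (p.map Γ.w) W <| by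
    intro n hn
    obtain ⟨e, -, rfl⟩ := List.mem_map.1 hn
    exact hW e
  rwa [List.length_map, smul_eq_mul, mul_comm] at this

theorem exists_isCycle_of_not_nodup (hp : Γ.IsWalk x p y) (h : ¬ (x :: p.map Γ.t).Nodup) :
    ∃ a c b, p = a ++ c ++ b ∧ Γ.IsCycle c := by
  induction p generalizing x with
  | nil => simp at h
  | cons e p ih =>
    have hep := hp
    obtain ⟨rfl, hp⟩ := hp
    by_cases hn : ((e :: p).map Γ.t).Nodup
    · have hmem : Γ.s e ∈ (e :: p).map Γ.t := by
        by_contra hx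
        exact h (List.nodup_cons.2 ⟨hx, hn⟩)
      obtain ⟨f, hf, hfx⟩ := List.mem_map.1 hmem
      obtain ⟨a, b, hab⟩ := List.append_of_mem hf
      rw [List.append_cons] at hab
      rw [hab] at hep hn ⊢
      obtain ⟨z, hz, -⟩ := isWalk_append.1 hep
      obtain ⟨v, hv, hvf, -⟩ := isWalk_append.1 hz
      refine ⟨[], a ++ [f], b, rfl, by simp, ⟨Γ.s e, isWalk_append.2 ⟨v, hv, hvf, hfx⟩⟩, ?_⟩
      rw [List.map_append] at hn
      exact hn.of_append_left
    · obtain ⟨a, c, b, rfl, hc⟩ := ih hp hn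
      exact ⟨e :: a, c, b, rfl, hc⟩

theorem exists_isCycle_of_card_le [Finite V] (hp : Γ.IsWalk x p y) (h : Nat.card V ≤ p.length) :
    ∃ a c b, p = a ++ c ++ b ∧ Γ.IsCycle c ∧ (a ++ c).length ≤ Nat.card V := by
  have := Fintype.ofFinite V
  rw [← List.take_append_drop (Nat.card V) p] at hp
  obtain ⟨z, hz, -⟩ := isWalk_append.1 hp
  have hlen : (p.take (Nat.card V)).length = Nat.card V := List.length_take_of_le h
  obtain ⟨a, c, b, hacb, hc⟩ := exists_isCycle_of_not_nodup hz fun hn => by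
    have := hn.length_le_card
    rw [List.length_cons, List.length_map, hlen, Nat.card_eq_fintype_card] at this
    omega
  refine ⟨a, c, b ++ p.drop (Nat.card V), ?_, hc, ?_⟩
  · rw [← List.append_assoc, ← hacb, List.take_append_drop]
  · rw [← hlen, hacb, List.length_append (bs := b)]
    exact Nat.le_add_right _ _

theorem exists_perm_isWalk_of_mem_supp (hp : Γ.IsWalk x p x) (hy : y ∈ Γ.supp p) :
    ∃ p', p'.Perm p ∧ Γ.IsWalk y p' y := by
  obtain ⟨e, he, hey⟩ := hy
  obtain ⟨a, b, rfl⟩ := List.append_of_mem he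
  obtain ⟨z, ha, rfl, hb⟩ := isWalk_append.1 hp
  rcases hey with rfl | rfl
  · exact ⟨e :: b ++ a, List.perm_append_comm, isWalk_append.2 ⟨x, ⟨rfl, hb⟩, ha⟩⟩
  · refine ⟨b ++ (a ++ [e]), ?_, isWalk_append.2 ⟨x, hb, isWalk_append.2 ⟨_, ha, rfl, rfl⟩⟩⟩
    rw [List.append_cons a e b]
    exact List.perm_append_comm

theorem dist_lt_iff {i : ℕ} : Γ.dist x y < i ↔ ∃ p, Γ.IsWalk x p y ∧ Γ.weight p < i := by
  simp only [dist, iInf_lt_iff, Nat.cast_lt, exists_prop]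

theorem dist_le_iff {i : ℕ} : Γ.dist x y ≤ i ↔ ∃ p, Γ.IsWalk x p y ∧ Γ.weight p ≤ i := by
  rw [← ENat.lt_add_one_iff (ENat.natCast_ne_top i), ← Nat.cast_add_one, dist_lt_iff]
  simp only [Nat.lt_succ_iff]

end WGraph

namespace PeriodicGraph

variable {L V E : Type*} [AddCommGroup L] [AddAction L V] [AddAction L E]
variable {Γ : PeriodicGraph L V E} {x y : V} {p : List E}
  {q : List (AddAction.orbitRel.Quotient L E)}

theorem isWalk_vadd (h : Γ.IsWalk x p y) (u : L) :
    Γ.IsWalk (u +ᵥ x) (p.map (u +ᵥ ·)) (u +ᵥ y) := by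
  induction p generalizing x with
  | nil => exact congrArg (u +ᵥ ·) h
  | cons e p ih =>
    obtain ⟨rfl, h⟩ := h
    refine ⟨Γ.s_vadd u e, ?_⟩
    dsimp only
    rw [Γ.t_vadd]
    exact ih h

theorem weight_vadd (p : List E) (u : L) : Γ.weight (p.map (u +ᵥ ·)) = Γ.weight p := by
  simp only [WGraph.weight, List.map_map, Function.comp_def, Γ.w_vadd]

theorem isWalk_quot (h : Γ.IsWalk x p y) :
    Γ.quot.IsWalk (orbitClass L x) (p.map (orbitClass L)) (orbitClass L y) := by
  induction p generalizing x with
  | nil => exact congrArg (orbitClass L) h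
  | cons e p ih =>
    obtain ⟨rfl, h⟩ := h
    exact ⟨rfl, ih h⟩

theorem weight_quot (p : List E) : Γ.quot.weight (p.map (orbitClass L)) = Γ.weight p := by
  simp only [WGraph.weight, List.map_map]
  rfl

theorem weight_le_card_of_isCycle (h : Γ.Unweighted) (hq : Γ.quot.IsCycle q) :
    Γ.quot.weight q ≤ Nat.card (AddAction.orbitRel.Quotient L V) := by
  have := Γ.finite_V
  have := Fintype.ofFinite (AddAction.orbitRel.Quotient L V)
  have hw : Γ.quot.weight q ≤ 1 * q.length :=
    WGraph.weight_le_mul_length (by rintro ⟨e⟩; exact (h e).le) q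
  have hlen := hq.2.2.length_le_card
  rw [List.length_map, ← Nat.card_eq_fintype_card] at hlen
  omega

theorem exists_equivariant (Γ : PeriodicGraph L V E) :
    ∃ κ : V → L, ∀ u x, κ (u +ᵥ x) = u + κ x := by
  have hrep (x : V) : ∃ u : L, u +ᵥ (orbitClass L x).out = x :=
    orbitClass_eq_iff.1 (Quotient.out_eq _).symm
  choose κ hκ using hrep
  refine ⟨κ, fun u x => eq_of_sub_eq_zero (Γ.free_V _ (orbitClass L x).out ?_)⟩
  have hux : κ (u +ᵥ x) +ᵥ (orbitClass L x).out = u +ᵥ x := by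
    have := hκ (u +ᵥ x)
    rwa [orbitClass_eq_iff.2 ⟨u, rfl⟩] at this
  rw [sub_eq_neg_add, add_vadd, hux, neg_vadd_eq_iff, add_vadd, hκ]

/-- An `L`-equivariant map `V → L`; it refines a realization `V → L_ℝ` so as to keep track of
torsion. -/
noncomputable def coord (Γ : PeriodicGraph L V E) : V → L := Γ.exists_equivariant.choose

theorem coord_vadd (u : L) (x : V) : Γ.coord (u +ᵥ x) = u + Γ.coord x :=
  Γ.exists_equivariant.choose_spec u x

/-- The change of `coord` along an edge. -/
noncomputable def edgeTranslation (Γ : PeriodicGraph L V E) : AddAction.orbitRel.Quotient L E → L :=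
  Quotient.lift (fun e => Γ.coord (Γ.t e) - Γ.coord (Γ.s e)) <| by
    rintro _ b ⟨u, rfl⟩
    simp only [Γ.t_vadd, Γ.s_vadd, coord_vadd, add_sub_add_left_eq_sub]

/-- The `L`-valued version of `mu`. -/
noncomputable def translation (Γ : PeriodicGraph L V E)
    (q : List (AddAction.orbitRel.Quotient L E)) : L :=
  (q.map Γ.edgeTranslation).sum

theorem translation_map (h : Γ.IsWalk x p y) :
    Γ.translation (p.map (orbitClass L)) = Γ.coord y - Γ.coord x := by
  induction p generalizing x with
  | nil =>
    obtain rfl : x = y := h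
    simp [translation]
  | cons e p ih =>
    obtain ⟨rfl, h⟩ := h
    have := ih h
    simp only [translation, List.map_cons, List.sum_cons] at this ⊢
    rw [this]
    exact sub_add_sub_cancel' (Γ.coord (Γ.t e)) (Γ.coord (Γ.s e)) (Γ.coord y)

theorem translation_vadd (h : Γ.IsWalk x p y) (hxy : orbitClass L x = orbitClass L y) :
    Γ.translation (p.map (orbitClass L)) +ᵥ x = y := by
  obtain ⟨u, rfl⟩ := orbitClass_eq_iff.1 hxy.symm
  rw [translation_map h, coord_vadd, add_sub_cancel_right]

theorem mu_eq_one_tmul_translation {z : AddAction.orbitRel.Quotient L V}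
    (h : Γ.quot.IsWalk z q z) : Γ.mu q = (1 : ℝ) ⊗ₜ[ℤ] Γ.translation q := by
  obtain ⟨x, rfl⟩ := Quotient.exists_rep z
  obtain ⟨p, y, hp, rfl, hy⟩ := Γ.exists_lift q x _ h
  refine Γ.mu_eq_tmul p x _ ?_
  rwa [translation_vadd hp hy.symm]

/-- The effect of a closed walk on walks in `Γ` with a marked weight: `translation` together with
the weight. -/
noncomputable def shift (Γ : PeriodicGraph L V E)
    (q : List (AddAction.orbitRel.Quotient L E)) : L × ℤ :=
  (Γ.translation q, Γ.quot.weight q)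

theorem nu_eq_velocity_shift {z : AddAction.orbitRel.Quotient L V} (h : Γ.quot.IsWalk z q z) :
    Γ.nu q = velocity (Γ.shift q) := by
  rw [nu, mu_eq_one_tmul_translation h, velocity, shift, Int.cast_natCast]

theorem shift_perm {q' : List (AddAction.orbitRel.Quotient L E)} (h : q.Perm q') :
    Γ.shift q = Γ.shift q' :=
  Prod.ext (h.map Γ.edgeTranslation).sum_eq (congrArg Nat.cast (h.map Γ.quot.w).sum_eq)

theorem shift_snd_pos (hq : q ≠ []) : 0 < (Γ.shift q).2 :=
  Int.natCast_pos.2 (WGraph.weight_pos hq)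

section GradedBall

/-- The componentwise action of `L × ℤ` on `V × ℤ`; Mathlib only lets one monoid act on a
product. -/
abbrev gradedAction (L V : Type*) [AddCommGroup L] [AddAction L V] :
    AddAction (L × ℤ) (V × ℤ) where
  vadd a x := (a.1 +ᵥ x.1, a.2 + x.2)
  zero_vadd x := Prod.ext (zero_vadd L x.1) (zero_add x.2)
  add_vadd a b x := Prod.ext (add_vadd a.1 b.1 x.1) (add_assoc a.2 b.2 x.2)

attribute [local instance] gradedAction

theorem graded_vadd_def (a : L × ℤ) (x : V × ℤ) : a +ᵥ x = (a.1 +ᵥ x.1, a.2 + x.2) := rfl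

theorem exists_isCycle_of_card_le (hp : Γ.IsWalk x p y)
    (h : Nat.card (AddAction.orbitRel.Quotient L V) ≤ p.length) :
    ∃ a c b z, p = a ++ c ++ b ∧
      (a ++ c).length ≤ Nat.card (AddAction.orbitRel.Quotient L V) ∧
      Γ.quot.IsCycle (c.map (orbitClass L)) ∧
      Γ.IsWalk x a z ∧ Γ.IsWalk z c (Γ.translation (c.map (orbitClass L)) +ᵥ z) ∧
      Γ.IsWalk (Γ.translation (c.map (orbitClass L)) +ᵥ z) b y := by
  have := Γ.finite_V
  obtain ⟨a', c', b', hsplit, hc', hlen⟩ := WGraph.exists_isCycle_of_card_le (isWalk_quot hp)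
    (by rwa [List.length_map])
  obtain ⟨ac, b, rfl, hac, rfl⟩ := List.map_eq_append_iff.1 hsplit
  obtain ⟨a, c, rfl, rfl, rfl⟩ := List.map_eq_append_iff.1 hac
  obtain ⟨z', hzz', hb⟩ := WGraph.isWalk_append.1 hp
  obtain ⟨z, ha, hc⟩ := WGraph.isWalk_append.1 hzz'
  have htrans := translation_vadd hc (hc'.eq_of_isWalk (isWalk_quot hc))
  rw [← List.map_append, List.length_map] at hlen
  exact ⟨a, c, b, z, rfl, hlen, hc', ha, htrans.symm ▸ hc, htrans.symm ▸ hb⟩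

/-- The walk `p'` is `p` with the cycles `cs'` cut out and the remaining pieces translated so as to
fit together. -/
theorem exists_removable_cycles (m : ℕ) (hp : Γ.IsWalk x p y)
    (hlen : m * Nat.card (AddAction.orbitRel.Quotient L V) ≤ p.length) :
    ∃ cs : List (List (AddAction.orbitRel.Quotient L E)), cs.length = m ∧
      (∀ c ∈ cs, Γ.quot.IsCycle c) ∧ ∀ cs' : List (List (AddAction.orbitRel.Quotient L E)),
        cs'.Sublist cs → ∃ p' y', Γ.IsWalk x p' y' ∧
          (cs'.map Γ.shift).sum +ᵥ (y', (Γ.weight p' : ℤ)) = (y, (Γ.weight p : ℤ)) := by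
  induction m generalizing x p with
  | zero =>
    refine ⟨[], rfl, by simp, fun cs' h => ⟨p, y, hp, ?_⟩⟩
    rw [List.sublist_nil.1 h, List.map_nil, List.sum_nil, zero_vadd]
  | succ m ih =>
    rw [Nat.succ_mul] at hlen
    obtain ⟨a, c, b, z, rfl, hac, hcyc, ha, hc, hb⟩ :=
      exists_isCycle_of_card_le hp (le_of_add_le_right hlen)
    rw [List.length_append (bs := b)] at hlen
    obtain ⟨cs, rfl, hcs, hrem⟩ := ih hb (by omega)
    refine ⟨c.map (orbitClass L) :: cs, rfl, List.forall_mem_cons.2 ⟨hcyc, hcs⟩, ?_⟩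
    intro cs' hcs'
    rcases List.sublist_cons_iff.1 hcs' with h | ⟨cs', rfl, h⟩ <;>
      obtain ⟨p', y', hp', hsum⟩ := hrem cs' h <;>
      rw [graded_vadd_def, Prod.mk.injEq] at hsum
    · refine ⟨a ++ c ++ p', y', WGraph.isWalk_append.2 ⟨_, WGraph.isWalk_append.2 ⟨z, ha, hc⟩, hp'⟩,
        Prod.ext hsum.1 ?_⟩
      simp only [graded_vadd_def, WGraph.weight_append, Nat.cast_add, ← hsum.2]
      ring
    · have hp'' := isWalk_vadd hp' (-Γ.translation (c.map (orbitClass L)))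
      rw [neg_vadd_vadd] at hp''
      refine ⟨_, _, WGraph.isWalk_append.2 ⟨z, ha, hp''⟩, Prod.ext ?_ ?_⟩
      · simp only [graded_vadd_def, List.map_cons, List.sum_cons, Prod.fst_add, shift, vadd_vadd]
        rw [add_neg_cancel_comm, hsum.1]
      · simp only [graded_vadd_def, List.map_cons, List.sum_cons, Prod.snd_add, shift,
          WGraph.weight_append, weight_vadd, weight_quot, Nat.cast_add, ← hsum.2]
        ring

/-- The pairs `(y, i)` with `d(x₀, y) ≤ i`. -/
def gradedBall (Γ : PeriodicGraph L V E) (x₀ : V) : Set (V × ℤ) :=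
  {x | ∃ p, Γ.IsWalk x₀ p x.1 ∧ (Γ.weight p : ℤ) ≤ x.2}

theorem mem_gradedBall_natCast {x₀ : V} {i : ℕ} :
    (y, (i : ℤ)) ∈ Γ.gradedBall x₀ ↔ Γ.dist x₀ y ≤ i := by
  rw [WGraph.dist_le_iff]
  simp only [gradedBall, Set.mem_ofPred_eq, Nat.cast_le]

theorem mem_gradedBall_natCast_sub_one {x₀ : V} {i : ℕ} :
    (y, (i : ℤ) - 1) ∈ Γ.gradedBall x₀ ↔ Γ.dist x₀ y < i := by
  rw [WGraph.dist_lt_iff]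
  simp only [gradedBall, Set.mem_ofPred_eq, Int.le_sub_one_iff, Nat.cast_lt]

theorem isFinitelyGraded_gradedBall (Γ : PeriodicGraph L V E) (x₀ : V) :
    IsFinitelyGraded Prod.snd (Γ.gradedBall x₀) where
  nonneg := fun _ ⟨_, _, hp⟩ => (Int.natCast_nonneg _).trans hp
  finite_fiber i := by
    refine ((Γ.finite_walk_ends i.toNat x₀).prod (Set.finite_singleton i)).subset ?_
    rintro ⟨y, j⟩ ⟨⟨p, hp, hw⟩, rfl⟩
    have hlen := WGraph.length_le_weight (Γ := Γ.toWGraph) p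
    dsimp only at hw
    exact ⟨⟨p, hp, by dsimp only; omega⟩, rfl⟩

theorem zero_one_mem_translationSubmonoid (Γ : PeriodicGraph L V E) (x₀ : V) :
    (0, 1) ∈ translationSubmonoid (L × ℤ) (Γ.gradedBall x₀) := by
  rintro ⟨y, i⟩ ⟨p, hp, hi⟩
  refine ⟨p, by rwa [graded_vadd_def, zero_vadd], hi.trans ?_⟩
  exact le_add_of_nonneg_left zero_le_one

theorem mem_translationSubmonoid_of_isWalk {u : L} (h : Γ.IsWalk x p (u +ᵥ x)) :
    (u, (Γ.weight p : ℤ)) ∈ translationSubmonoid (L × ℤ) (Γ.gradedBall x) := by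
  rintro ⟨y, i⟩ ⟨p', hp', hi⟩
  refine ⟨p ++ p'.map (u +ᵥ ·), WGraph.isWalk_append.2 ⟨_, h, isWalk_vadd hp' u⟩, ?_⟩
  rw [WGraph.weight_append, weight_vadd, Nat.cast_add]
  exact add_le_add_right hi _

theorem shift_mem_translationSubmonoid {z : AddAction.orbitRel.Quotient L V}
    (hq : Γ.quot.IsWalk z q z) (hx : orbitClass L x ∈ Γ.quot.supp q) :
    Γ.shift q ∈ translationSubmonoid (L × ℤ) (Γ.gradedBall x) := by
  obtain ⟨q', hperm, hq'⟩ := WGraph.exists_perm_isWalk_of_mem_supp hq hx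
  obtain ⟨p, y, hp, rfl, hy⟩ := Γ.exists_lift q' x _ hq'
  rw [← shift_perm hperm, shift, weight_quot]
  refine mem_translationSubmonoid_of_isWalk ?_
  rwa [translation_vadd hp hy.symm]

open scoped Pointwise in
theorem gradedBall_sdiff_fiber (Γ : PeriodicGraph L V E) (x₀ : V) (i : ℕ) :
    {x ∈ Γ.gradedBall x₀ \ (((0, 1) : L × ℤ) +ᵥ Γ.gradedBall x₀) | x.2 = i} =
      (·, (i : ℤ)) '' Γ.sphere x₀ i := by
  have hmem (y : V) : (y, (i : ℤ)) ∈ Γ.gradedBall x₀ \ (((0, 1) : L × ℤ) +ᵥ Γ.gradedBall x₀) ↔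
      y ∈ Γ.sphere x₀ i := by
    have hshift : -((0, 1) : L × ℤ) +ᵥ (y, (i : ℤ)) = (y, (i : ℤ) - 1) :=
      Prod.ext (by simp [graded_vadd_def]) (neg_add_eq_sub 1 (i : ℤ))
    rw [Set.mem_sdiff, Set.mem_vadd_set_iff_neg_vadd_mem, hshift, mem_gradedBall_natCast,
      mem_gradedBall_natCast_sub_one, not_lt]
    exact antisymm_iff
  ext ⟨y, j⟩
  constructor
  · rintro ⟨h, rfl : j = i⟩
    exact ⟨y, (hmem y).1 h, rfl⟩
  · rintro ⟨y, h, hy⟩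
    rw [← hy]
    exact ⟨(hmem y).2 h, rfl⟩

open scoped Pointwise in
theorem hilbertSeries_gradedBall_mul_one_sub_X (Γ : PeriodicGraph L V E) (x₀ : V) :
    hilbertSeries Prod.snd (Γ.gradedBall x₀) * (1 - PowerSeries.X) = Γ.growthSeries x₀ := by
  have hmul := hilbertSeries_mul_one_sub_X_pow (d := 1) (Γ.isFinitelyGraded_gradedBall x₀)
    (u := ((0, 1) : L × ℤ)) fun x => add_comm 1 x.2
  have hempty : Γ.gradedBall x₀ \ (-((0, 1) : L × ℤ) +ᵥ Γ.gradedBall x₀) = ∅ :=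
    Set.sdiff_eq_empty.2 fun x hx => Set.mem_vadd_set_iff_neg_vadd_mem.2 <| by
      rw [neg_neg]
      exact Γ.zero_one_mem_translationSubmonoid x₀ x hx
  rw [pow_one, hempty] at hmul
  have hzero : hilbertSeries Prod.snd (∅ : Set (V × ℤ)) = 0 := by
    ext i
    simp [hilbertSeries]
  rw [hmul, hzero, mul_zero, sub_zero]
  ext i
  rw [hilbertSeries, PowerSeries.coeff_mk, gradedBall_sdiff_fiber,
    Set.ncard_image_of_injective _ (Prod.mk_left_injective (i : ℤ)), WGraph.growthSeries,
    PowerSeries.coeff_mk, WGraph.growthSeq]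

theorem exists_weight_le_mul_length (Γ : PeriodicGraph L V E) :
    ∃ W, ∀ p, Γ.weight p ≤ W * p.length := by
  have := Γ.finite_E
  obtain ⟨W, hW⟩ := (Set.finite_range Γ.quot.w).bddAbove
  exact ⟨W, WGraph.weight_le_mul_length fun e => hW ⟨orbitClass L e, rfl⟩⟩

theorem exists_repeated_removable_cycle (Γ : PeriodicGraph L V E) (N : ℕ) :
    ∃ B, ∀ {x y p}, Γ.IsWalk x p y → B ≤ p.length → ∃ c, Γ.quot.IsCycle c ∧
      ∃ p' y', Γ.IsWalk x p' y' ∧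
        N • Γ.shift c +ᵥ (y', (Γ.weight p' : ℤ)) = (y, (Γ.weight p : ℤ)) := by
  set C := Γ.finite_cycles.toFinset
  refine ⟨(C.card * N + 1) * Nat.card (AddAction.orbitRel.Quotient L V), fun hp hlen => ?_⟩
  obtain ⟨cs, hcs, hcyc, hrem⟩ := exists_removable_cycles _ hp hlen
  obtain ⟨c, hc, hsub⟩ := exists_replicate_sublist C (N := N)
    (fun c hc => Γ.finite_cycles.mem_toFinset.2 (hcyc c hc)) (hcs ▸ Nat.lt_succ_self _)
  have := hrem _ hsub
  rw [List.map_replicate, List.sum_replicate] at this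
  exact ⟨c, Γ.finite_cycles.mem_toFinset.1 hc, this⟩

theorem exists_descent (Γ : PeriodicGraph L V E) (x₀ : V) {G : Set (L × ℤ)} (h01 : (0, 1) ∈ G)
    (hG : ∀ a ∈ G, a ∈ translationSubmonoid (L × ℤ) (Γ.gradedBall x₀))
    (hcyc : ∀ c, Γ.quot.IsCycle c → ∃ N : ℕ, 0 < N ∧ N • Γ.shift c ∈ AddSubmonoid.closure G) :
    ∃ K : ℤ, ∀ x ∈ Γ.gradedBall x₀, K ≤ x.2 → ∃ a ∈ G, -a +ᵥ x ∈ Γ.gradedBall x₀ := by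
  obtain ⟨N, hN, hmem⟩ := exists_common_nsmul_mem (Γ.finite_cycles.image Γ.shift)
    (Set.forall_mem_image.2 hcyc)
  obtain ⟨B, hB⟩ := Γ.exists_repeated_removable_cycle N
  obtain ⟨W, hW⟩ := Γ.exists_weight_le_mul_length
  refine ⟨W * B + 1, ?_⟩
  rintro ⟨y, i⟩ ⟨p, hp, hi⟩ hK
  dsimp only at hp hi hK
  rcases hi.lt_or_eq with hlt | rfl
  · refine ⟨(0, 1), h01, p, ?_, ?_⟩
    · simpa [graded_vadd_def] using hp
    · exact (Int.le_sub_one_of_lt hlt).trans_eq (neg_add_eq_sub 1 i).symm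
  · have hlen : B ≤ p.length := by
      by_contra! hlt
      have := (hW p).trans (Nat.mul_le_mul_left W hlt.le)
      lia
    obtain ⟨c, hc, p', y', hp', hsum⟩ := hB hp hlen
    rw [← hsum]
    refine exists_neg_vadd_mem_of_mem_closure hG (hmem _ ⟨c, hc, rfl⟩) (fun h => ?_)
      ⟨p', hp', le_rfl⟩
    exact (nsmul_pos (shift_snd_pos hc.1) hN.ne').ne' (congrArg Prod.snd h)

theorem exists_growthSeries_mul_prod (Γ : PeriodicGraph L V E) (x₀ : V) {ι : Type*} (S : Finset ι)
    (q : ι → List (AddAction.orbitRel.Quotient L E))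
    (hclosed : ∀ s ∈ S, ∃ z, Γ.quot.IsWalk z (q s) z)
    (hsupp : ∀ s ∈ S, orbitClass L x₀ ∈ Γ.quot.supp (q s))
    (hspan : ∀ c, Γ.quot.IsCycle c →
      Γ.nu c ∈ convexHull ℝ (insert 0 ((fun s => Γ.nu (q s)) '' S))) :
    ∃ Q : Polynomial ℤ,
      Γ.growthSeries x₀ * ∏ s ∈ S, (1 - PowerSeries.X ^ Γ.quot.weight (q s)) =
        (Q : PowerSeries ℤ) := by
  let g : Option ι → L × ℤ := fun o => o.elim (0, 1) fun s => Γ.shift (q s)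
  let d : Option ι → ℕ := fun o => o.elim 1 fun s => Γ.quot.weight (q s)
  have hdeg (o : Option ι) (x : V × ℤ) : (g o +ᵥ x).2 = x.2 + d o := by
    cases o <;> exact add_comm _ _
  have hne : ∀ s ∈ S, q s ≠ [] := fun s hs => List.ne_nil_of_mem (hsupp s hs).choose_spec.1
  have hd : ∀ o ∈ Finset.insertNone S, 0 < d o :=
    Finset.forall_mem_insertNone.2 ⟨one_pos, fun s hs => WGraph.weight_pos (hne s hs)⟩
  have hg_pos : ∀ o ∈ Finset.insertNone S, 0 < (g o).2 :=
    Finset.forall_mem_insertNone.2 ⟨one_pos, fun s hs => shift_snd_pos (hne s hs)⟩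
  have hg : ∀ o ∈ Finset.insertNone S,
      g o ∈ translationSubmonoid (L × ℤ) (Γ.gradedBall x₀) :=
    Finset.forall_mem_insertNone.2 ⟨Γ.zero_one_mem_translationSubmonoid x₀, fun s hs =>
      shift_mem_translationSubmonoid (hclosed s hs).choose_spec (hsupp s hs)⟩
  have hvelocity : insert 0 ((fun s => Γ.nu (q s)) '' S) ⊆
      velocity '' (g '' (Finset.insertNone S : Finset (Option ι))) := by
    rw [Set.insert_subset_iff, Set.image_subset_iff]
    refine ⟨⟨_, ⟨none, Finset.none_mem_insertNone, rfl⟩, by simp [g, velocity]⟩, fun s hs => ?_⟩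
    exact ⟨_, ⟨some s, Finset.some_mem_insertNone.2 hs, rfl⟩,
      (nu_eq_velocity_shift (hclosed s hs).choose_spec).symm⟩
  obtain ⟨K, hK⟩ := Γ.exists_descent x₀ (G := g '' (Finset.insertNone S : Finset (Option ι)))
    ⟨none, Finset.none_mem_insertNone, rfl⟩ (Set.forall_mem_image.2 hg) fun c hc =>
      exists_nsmul_mem_closure (Set.forall_mem_image.2 hg_pos) (shift_snd_pos hc.1) <| by
        obtain ⟨z, hz⟩ := hc.2.1
        rw [← nu_eq_velocity_shift hz]
        exact convexHull_mono hvelocity (hspan c hc)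
  obtain ⟨Q, hQ⟩ := exists_hilbertSeries_mul_prod_of_descent g d hdeg (Finset.insertNone S) hd
    (Γ.isFinitelyGraded_gradedBall x₀) hg fun x hx hKx => by
      obtain ⟨_, ⟨o, ho, rfl⟩, hox⟩ := hK x hx hKx
      exact ⟨o, ho, hox⟩
  refine ⟨Q, ?_⟩
  rw [← hQ, Finset.prod_insertNone, ← hilbertSeries_gradedBall_mul_one_sub_X, mul_assoc]
  simp only [d, Option.elim_none, Option.elim_some, pow_one]

end GradedBall

theorem nu_mem_convexHull (hq : Γ.quot.IsCycle q) :
    Γ.nu q ∈ convexHull ℝ (insert 0 (Γ.nonzeroVertices : Set (ℝ ⊗[ℤ] L))) := by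
  have hmem : Γ.nu q ∈ Γ.growthPolytope := subset_convexHull _ _ (Or.inl ⟨q, hq, rfl⟩)
  rw [growthPolytope, ← convexHull_extremePoints_convexHull
    ((Γ.finite_cycles.image Γ.nu).union (Set.finite_singleton 0))] at hmem
  refine convexHull_mono (fun v hv => or_iff_not_imp_left.2 fun hv₀ => ?_) hmem
  exact Γ.finite_vertices.mem_toFinset.2 ⟨hv, hv₀⟩

end PeriodicGraph

theorem theorem5p1_general {L V E : Type*} [AddCommGroup L] [AddAction L V] [AddAction L E]
    (Γ : PeriodicGraph L V E) (x₀ : V) (hx₀ : Γ.PInitial x₀) :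
    (∀ q : ℝ ⊗[ℤ] L → List (AddAction.orbitRel.Quotient L E),
      (∀ v ∈ Γ.nonzeroVertices,
        Γ.quot.IsCycle (q v) ∧ Γ.nu (q v) = v ∧ orbitClass L x₀ ∈ Γ.quot.supp (q v)) →
      IsQuasiPeriod (fun i => (Γ.growthSeq x₀ i : ℂ))
        (Γ.nonzeroVertices.lcm fun v => Γ.quot.weight (q v)) ∧
      ∃ Q : Polynomial ℤ,
        Γ.growthSeries x₀ *
            ∏ v ∈ Γ.nonzeroVertices, (1 - PowerSeries.X ^ Γ.quot.weight (q v)) =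
          (Q : PowerSeries ℤ)) ∧
    (Γ.Unweighted →
      IsQuasiPeriod (fun i => (Γ.growthSeq x₀ i : ℂ))
        ((Finset.Icc 1 (Nat.card (AddAction.orbitRel.Quotient L V))).lcm id)) := by
  have hrational (q : ℝ ⊗[ℤ] L → List (AddAction.orbitRel.Quotient L E))
      (hq : ∀ v ∈ Γ.nonzeroVertices,
        Γ.quot.IsCycle (q v) ∧ Γ.nu (q v) = v ∧ orbitClass L x₀ ∈ Γ.quot.supp (q v)) :=
    Γ.exists_growthSeries_mul_prod x₀ Γ.nonzeroVertices q (fun v hv => (hq v hv).1.2.1)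
      (fun v hv => (hq v hv).2.2) fun c hc => by
        rw [Set.image_congr fun v hv => (hq v hv).2.1, Set.image_id']
        exact PeriodicGraph.nu_mem_convexHull hc
  refine ⟨fun q hq => ?_, fun hunw => ?_⟩
  · obtain ⟨Q, hQ⟩ := hrational q hq
    refine ⟨.of_mul_prod (Nat.pos_of_ne_zero ?_) _ _ (fun v hv => Finset.dvd_lcm hv) hQ, Q, hQ⟩
    exact Finset.lcm_ne_zero_iff.2 fun v hv => (WGraph.weight_pos (hq v hv).1.1).ne'
  · choose! q hq using hx₀
    obtain ⟨Q, hQ⟩ := hrational q hq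
    refine .of_mul_prod (Nat.pos_of_ne_zero ?_) _ _ (fun v hv => ?_) hQ
    · exact Finset.lcm_ne_zero_iff.2 fun n hn => Nat.one_le_iff_ne_zero.1 (Finset.mem_Icc.1 hn).1
    · have hle := PeriodicGraph.weight_le_card_of_isCycle hunw (hq v hv).1
      exact Finset.dvd_lcm (f := id) (Finset.mem_Icc.2 ⟨WGraph.weight_pos (hq v hv).1.1, hle⟩)

theorem theorem5p1 {L V E : Type*} [AddCommGroup L] [Module.Free ℤ L] [Module.Finite ℤ L]
    [AddAction L V] [AddAction L E] (Γ : PeriodicGraph L V E) (x₀ : V) (hx₀ : Γ.PInitial x₀) :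
    (∀ q : ℝ ⊗[ℤ] L → List (AddAction.orbitRel.Quotient L E),
      (∀ v ∈ Γ.nonzeroVertices,
        Γ.quot.IsCycle (q v) ∧ Γ.nu (q v) = v ∧ orbitClass L x₀ ∈ Γ.quot.supp (q v)) →
      IsQuasiPeriod (fun i => (Γ.growthSeq x₀ i : ℂ))
        (Γ.nonzeroVertices.lcm fun v => Γ.quot.weight (q v)) ∧
      ∃ Q : Polynomial ℤ,
        Γ.growthSeries x₀ *
            ∏ v ∈ Γ.nonzeroVertices, (1 - PowerSeries.X ^ Γ.quot.weight (q v)) =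
          (Q : PowerSeries ℤ)) ∧
    (Γ.Unweighted →
      IsQuasiPeriod (fun i => (Γ.growthSeq x₀ i : ℂ))
        ((Finset.Icc 1 (Nat.card (AddAction.orbitRel.Quotient L V))).lcm id)) :=
  theorem5p1_general Γ x₀ hx₀
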